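/- Let $p_1,\dots,p_n$ be distinct points in the plane. A straight-line graph $T$ on these points is *crossing-free* if no edge passes through one of the points other than its endpoints and two distinct edges meet at most in a common endpoint. For such a graph let $d_T(p_i,p_j)$ be the link distance, i.e. the smallest number of edges of a path in $T$ from $p_i$ to $p_j$ ($\infty$ if there is none), and put $$\mathcal W(T)=\sum_{1\le i<j\le n} d_T(p_i,p_j),$$ which is the average distance up to a normalizing factor that depends only on $n$. A *triangulation of the point set* $S=\{p_1,\dots,p_n\}$ is a (inclusion-)maximal crossing-free graph on $S$. A *triangulation of a simple polygon* ($n\ge 3$ vertices $p_1,\dots,p_n$ in cyclic order) is a maximal crossing-free graph consisting of all boundary edges and a subset of the diagonals, where a diagonal is a segment between two non-consecutive vertices that lies, except for its endpoints, in the interior of the polygon. A *fan triangulation* is a triangulation in which some point or vertex is adjacent to all the others. (1) Let $P$ be a simple polygon that is *one-vertex-visible*: some vertex is joined to every other vertex by a diagonal or a boundary edge of $P$. Then $P$ has a fan triangulation, all fan triangulations $F$ of $P$ have the same value $\mathcal W(F)$, and $\mathcal W(F)\le \mathcal W(T)$ for every triangulation $T$ of $P$. (2) Let $S$ be a finite set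 of points in the plane that is *one-point-visible*: there is $p\in S$ such that for every $q\in S$, $q\ne p$, the segment $pq$ contains no point of $S$ except $p$ and $q$. Then $S$ has a fan triangulation, all fan triangulations $F$ of $S$ have the same value $\mathcal W(F)$, and $\mathcal W(F)\le \mathcal W(T)$ for every triangulation $T$ of $S$. -/

import Mathlib

namespace MADT

/-- The Euclidean plane. -/
abbrev Plane : Type := EuclideanSpace ℝ (Fin 2)

/-- `p i` and `p j` see each other in the family `p`: the straight segment between them
contains no point of the family except at its endpoints. -/
def Sees {n : ℕ} (p : Fin n → Plane) (i j : Fin n) : Prop :=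
  ∀ k, p k ∈ segment ℝ (p i) (p j) → k = i ∨ k = j

/-- The graph `G`, drawn with straight segments on the points `p`, is crossing-free: no edge
passes through a point other than its endpoints, and the relative interiors of two distinct
edges are disjoint. -/
def CrossingFree {n : ℕ} (p : Fin n → Plane) (G : SimpleGraph (Fin n)) : Prop :=
  (∀ i j, G.Adj i j → Sees p i j) ∧
  ∀ i j k l, G.Adj i j → G.Adj k l → s(i, j) ≠ s(k, l) →
    Disjoint (openSegment ℝ (p i) (p j)) (openSegment ℝ (p k) (p l))

/-- A triangulation of a point set: a maximal crossing-free geometric graph on it. -/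
def IsTriangulation {n : ℕ} (p : Fin n → Plane) (T : SimpleGraph (Fin n)) : Prop :=
  Maximal (CrossingFree p) T

/-- Some point of the set can be connected to all other points. -/
def OnePointVisible {n : ℕ} (p : Fin n → Plane) : Prop :=
  ∃ i, ∀ j, j ≠ i → Sees p i j

/-- Some vertex (the fan handle) is adjacent to all other vertices. -/
def HasHandle {n : ℕ} (T : SimpleGraph (Fin n)) : Prop :=
  ∃ i, ∀ j, j ≠ i → T.Adj i j

/-- The total pairwise link distance `∑_{i < j} d_T(i, j)`, where `d_T` is the number of edges
of a shortest path (and `⊤` if there is no path). -/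
noncomputable def totalDist {n : ℕ} (T : SimpleGraph (Fin n)) : ℕ∞ :=
  ∑ i : Fin n, ∑ j ∈ Finset.Ioi i, T.edist i j

/-- A simple polygon: at least three vertices, pairwise distinct, and the boundary edges
(joining cyclically consecutive vertices) meet only at common endpoints. -/
def IsSimplePolygon {n : ℕ} (P : Polygon Plane n) : Prop :=
  3 ≤ n ∧ Function.Injective P.vertices ∧ CrossingFree P.vertices (SimpleGraph.cycleGraph n)

/-- The interior region of a polygon: the union of the bounded connected components of the
complement of its boundary. -/
def polygonInterior {n : ℕ} (P : Polygon Plane n) : Set Plane :=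
  {x | x ∉ P.boundary ℝ ∧ Bornology.IsBounded (connectedComponentIn (P.boundary ℝ)ᶜ x)}

/-- The segment between two distinct, non-consecutive vertices is a diagonal if it runs, except
for its endpoints, in the interior of the polygon. -/
def IsDiagonal {n : ℕ} (P : Polygon Plane n) (i j : Fin n) : Prop :=
  i ≠ j ∧ ¬ (SimpleGraph.cycleGraph n).Adj i j ∧
    openSegment ℝ (P i) (P j) ⊆ polygonInterior P

/-- A pair of vertices forming a boundary edge or a diagonal. -/
def IsBoundaryEdgeOrDiagonal {n : ℕ} (P : Polygon Plane n) (i j : Fin n) : Prop :=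
  (SimpleGraph.cycleGraph n).Adj i j ∨ IsDiagonal P i j

/-- Crossing-free graphs consisting of all boundary edges and a subset of the diagonals. -/
def IsPolygonPlaneGraph {n : ℕ} (P : Polygon Plane n) (G : SimpleGraph (Fin n)) : Prop :=
  SimpleGraph.cycleGraph n ≤ G ∧ (∀ i j, G.Adj i j → IsBoundaryEdgeOrDiagonal P i j) ∧
    CrossingFree P.vertices G

/-- A triangulation of a polygon: all boundary edges together with a maximal crossing-free set
of diagonals. -/
def IsPolygonTriangulation {n : ℕ} (P : Polygon Plane n) (T : SimpleGraph (Fin n)) : Prop :=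
  Maximal (IsPolygonPlaneGraph P) T

/-- Some vertex can be connected to all others with diagonals or boundary edges. -/
def OneVertexVisible {n : ℕ} (P : Polygon Plane n) : Prop :=
  ∃ i, ∀ j, j ≠ i → IsBoundaryEdgeOrDiagonal P i j

end MADT

/-! In any graph, two distinct vertices have distance 1 if they are adjacent and at least 2
otherwise, so the total distance is at least twice the number of pairs minus the number of edges. A
handle bounds all distances by 2 and gives equality (`HasHandle.edist_add`). Hence a fan is optimal
as soon as it has at least as many edges as every competitor (`HasHandle.totalDist_le`), and it
remains to show that triangulations have the largest possible number of edges.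

For point sets this is done by a charging argument instead of Euler's formula. After a shear all
abscissas are distinct and edges point from left to right. An edge `v s` is either the topmost right
edge at `v`, or it is followed by a next one `v t`. In the second case the leftmost point in the
wedge between them is directly below `v t` or directly above `v s`. An edge directly above or below
a given point is unique, so the number of edges is at most the number of points that are not
rightmost, plus the number of points with a segment of the point set above them, plus the same
number for below (`IsDrawing.card_le`). This bound depends only on the points. In a maximal drawing
it is attained (`IsMaxDrawing.le_card`): every point that is not rightmost has a right edge, and the
face between a point and the first edge above it is a triangle
(`IsMaxDrawing.triangle_of_isFirstAbove`).

For a polygon, a triangulation `F` is extended to a triangulation `M` of the vertex set. The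
additional edges run outside, so they are compatible with every other plane graph `T` of the
polygon. Comparing `T` together with `M \ F` to `M` shows that `T` has at most as many edges as `F`.
-/

namespace MADT

/-! ### Affine functions of one variable -/

/-- Affine functions of one real variable. -/
def IsAff (f : ℝ → ℝ) : Prop := ∃ m c : ℝ, ∀ t, f t = m * t + c

theorem IsAff.sub {f g : ℝ → ℝ} (hf : IsAff f) (hg : IsAff g) : IsAff fun t => f t - g t := by
  obtain ⟨m, c, h⟩ := hf
  obtain ⟨m', c', h'⟩ := hg
  exact ⟨m - m', c - c', fun t => by simp only [h, h']; ring⟩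

/-- An affine function which is positive at `p` and negative at `q` vanishes in between. -/
theorem IsAff.exists_zero {f : ℝ → ℝ} (hf : IsAff f) {p q : ℝ} (hp : 0 < f p) (hq : f q < 0) :
    ∃ s, f s = 0 ∧ ((p < s ∧ s < q) ∨ (q < s ∧ s < p)) := by
  obtain ⟨m, c, h⟩ := hf
  rw [h] at hp hq
  have hm : m ≠ 0 := by rintro rfl; linarith
  refine ⟨-c / m, by rw [h]; field_simp; ring, ?_⟩
  rcases lt_or_gt_of_ne hm with hm | hm
  · left
    constructor
    · rw [lt_div_iff_of_neg hm]; linarith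
    · rw [div_lt_iff_of_neg hm]; linarith
  · right
    constructor
    · rw [lt_div_iff₀ hm]; linarith
    · rw [div_lt_iff₀ hm]; linarith

/-- A negative value at `t` would force a zero strictly between `t₀` and `t`, hence inside the open
interval, even if `t` is one of its ends. -/
theorem IsAff.nonneg_of_ne_zero {f : ℝ → ℝ} (hf : IsAff f) {a b t₀ t : ℝ}
    (hne : ∀ s, a < s → s < b → f s ≠ 0) (h₀ : 0 < f t₀) (ha₀ : a < t₀) (hb₀ : t₀ < b)
    (ha : a ≤ t) (hb : t ≤ b) : 0 ≤ f t := by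
  by_contra! hneg
  obtain ⟨s, hs, h | h⟩ := hf.exists_zero h₀ hneg
  · exact hne s (by linarith) (by linarith) hs
  · exact hne s (by linarith) (by linarith) hs

theorem IsAff.pos_of_mem {f : ℝ → ℝ} (hf : IsAff f) {p q t : ℝ} (hp : 0 ≤ f p) (hq : 0 ≤ f q)
    (hpq : 0 < f p ∨ 0 < f q) (hpt : p < t) (htq : t < q) : 0 < f t := by
  obtain ⟨m, c, h⟩ := hf
  simp only [h] at *
  rcases hpq with h' | h'
  · nlinarith [mul_pos h' (sub_pos.2 htq), mul_nonneg hq (sub_pos.2 hpt).le]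
  · nlinarith [mul_pos h' (sub_pos.2 hpt), mul_nonneg hp (sub_pos.2 htq).le]

theorem IsAff.eq_zero {f : ℝ → ℝ} (hf : IsAff f) {p q : ℝ} (hp : f p = 0) (hq : f q = 0)
    (hpq : p ≠ q) (t : ℝ) : f t = 0 := by
  obtain ⟨m, c, h⟩ := hf
  rw [h] at *
  have hm : m = 0 := by
    have : m * (p - q) = 0 := by linarith
    exact (mul_eq_zero.1 this).resolve_right (sub_ne_zero.2 hpq)
  subst hm; linarith

theorem IsAff.nonneg_of_pos {f : ℝ → ℝ} (hf : IsAff f) {a b t : ℝ} (hab : a < b)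
    (h : ∀ s, a < s → s < b → 0 < f s) (ha : a ≤ t) (hb : t ≤ b) : 0 ≤ f t :=
  hf.nonneg_of_ne_zero (fun s h₁ h₂ => (h s h₁ h₂).ne') (h ((a + b) / 2) (by linarith)
    (by linarith)) (by linarith) (by linarith) ha hb

/-! ### Straight-line drawings directed from left to right -/

section Drawing

variable {V : Type*}

/-- The slope of the line through the points `i` and `j`. -/
noncomputable def slp (x y : V → ℝ) (i j : V) : ℝ := (y j - y i) / (x j - x i)

/-- The height at abscissa `t` of the line through the points `i` and `j`. -/
noncomputable def chord (x y : V → ℝ) (i j : V) (t : ℝ) : ℝ := y i + slp x y i j * (t - x i)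

variable {x y : V → ℝ} {E : V → V → Prop}

theorem chord_isAff (x y : V → ℝ) (i j : V) : IsAff (chord x y i j) :=
  ⟨slp x y i j, y i - slp x y i j * x i, fun t => by unfold chord; ring⟩

@[simp] theorem chord_left (i j : V) : chord x y i j (x i) = y i := by simp [chord]

theorem chord_right {i j : V} (h : x i < x j) : chord x y i j (x j) = y j := by
  unfold chord slp
  have : x j - x i ≠ 0 := by linarith
  field_simp; ring

theorem chord_eq_of_isAff {f : ℝ → ℝ} (hf : IsAff f) {i j : V} (hij : x i < x j)
    (hi : f (x i) = y i) (hj : f (x j) = y j) (t : ℝ) : chord x y i j t = f t := by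
  have := ((chord_isAff x y i j).sub hf).eq_zero (p := x i) (q := x j) (by simp [hi])
    (by rw [chord_right hij, hj, sub_self]) hij.ne t
  linarith

theorem chord_neg_y (i j : V) (t : ℝ) : chord x (fun k => -y k) i j t = -chord x y i j t := by
  unfold chord slp; ring

theorem chord_neg_x {i j : V} (h : x i < x j) (t : ℝ) :
    chord (fun k => -x k) y j i t = chord x y i j (-t) := by
  unfold chord slp
  have h₁ : x j - x i ≠ 0 := by linarith
  have h₂ : -x i - -x j ≠ 0 := by intro h; apply h₁; linarith
  have h₃ : -x i - -x j = x j - x i := by ring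
  simp only [h₃]
  field_simp; ring

theorem slp_lt_of_chord_lt {v s t : V} {r : ℝ} (hr : x v < r)
    (h : chord x y v s r < chord x y v t r) : slp x y v s < slp x y v t := by
  unfold chord at h
  exact lt_of_mul_lt_mul_right (a := r - x v) (by linarith) (by linarith)

theorem chord_lt_of_slp_lt {v s t : V} {r : ℝ} (hr : x v < r)
    (h : slp x y v s < slp x y v t) : chord x y v s r < chord x y v t r := by
  unfold chord
  have := mul_lt_mul_of_pos_right h (sub_pos.2 hr)
  linarith

/-- A crossing-free straight-line drawing; every edge `E i j` is directed from left to right. -/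
structure IsDrawing (x y : V → ℝ) (E : V → V → Prop) : Prop where
  lt : ∀ {i j}, E i j → x i < x j
  ne_chord : ∀ {i j}, E i j → ∀ k, x i < x k → x k < x j → y k ≠ chord x y i j (x k)
  eq_of_chord_eq : ∀ {i j k l}, E i j → E k l → ∀ t, x i < t → t < x j → x k < t → t < x l →
    chord x y i j t = chord x y k l t → i = k ∧ j = l

/-- A drawing to which no edge can be added without a crossing. -/
structure IsMaxDrawing (x y : V → ℝ) (E : V → V → Prop) : Prop extends IsDrawing x y E where
  inj : Function.Injective x
  maximal : ∀ {i j}, x i < x j → (∀ k, x i < x k → x k < x j → y k ≠ chord x y i j (x k)) →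
    (∀ k l, E k l → ∀ t, x i < t → t < x j → x k < t → t < x l →
      chord x y i j t = chord x y k l t → i = k ∧ j = l) → E i j

/-- The two reflections spare half of the arguments: this one exchanges above and below, and
`IsMaxDrawing.neg_x` exchanges left and right and therefore reverses the edges. -/
theorem IsDrawing.neg_y (h : IsDrawing x y E) : IsDrawing x (fun k => -y k) E where
  lt := h.lt
  ne_chord hE k h₁ h₂ := by
    rw [chord_neg_y, Ne, neg_inj]; exact h.ne_chord hE k h₁ h₂
  eq_of_chord_eq hE hE' t h₁ h₂ h₃ h₄ := by
    rw [chord_neg_y, chord_neg_y, neg_inj]; exact h.eq_of_chord_eq hE hE' t h₁ h₂ h₃ h₄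

theorem IsMaxDrawing.neg_y (h : IsMaxDrawing x y E) : IsMaxDrawing x (fun k => -y k) E where
  toIsDrawing := h.toIsDrawing.neg_y
  inj := h.inj
  maximal hij hp hc := by
    refine h.maximal hij (fun k h₁ h₂ => ?_) (fun k l hE t h₁ h₂ h₃ h₄ he => ?_)
    · have := hp k h₁ h₂
      rwa [chord_neg_y, Ne, neg_inj] at this
    · exact hc k l hE t h₁ h₂ h₃ h₄ (by rw [chord_neg_y, chord_neg_y, he])

theorem IsMaxDrawing.neg_x (h : IsMaxDrawing x y E) :
    IsMaxDrawing (fun k => -x k) y (fun i j => E j i) where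
  lt hE := neg_lt_neg (h.lt hE)
  ne_chord hE k h₁ h₂ := by
    rw [chord_neg_x (h.lt hE), neg_neg]
    exact h.ne_chord hE k (neg_lt_neg_iff.1 h₂) (neg_lt_neg_iff.1 h₁)
  eq_of_chord_eq hE hE' t h₁ h₂ h₃ h₄ := by
    rw [chord_neg_x (h.lt hE), chord_neg_x (h.lt hE')]
    intro he
    exact (h.eq_of_chord_eq hE hE' (-t) (by linarith) (by linarith) (by linarith) (by linarith)
      he).symm
  inj i j hij := h.inj (neg_injective hij)
  maximal {i j} hij hp hc := by
    have hji : x j < x i := neg_lt_neg_iff.1 hij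
    refine h.maximal hji (fun k h₁ h₂ => ?_) (fun k l hE t h₁ h₂ h₃ h₄ he => ?_)
    · have := hp k (neg_lt_neg h₂) (neg_lt_neg h₁)
      rwa [chord_neg_x hji, neg_neg] at this
    · exact (hc l k hE (-t) (by linarith) (by linarith) (by linarith) (by linarith)
        (by rw [chord_neg_x hji, chord_neg_x (h.lt hE), neg_neg, he])).symm

namespace IsDrawing

/-- Edges of different height somewhere are distinct, so their difference has no zero over the open
common range. Equality is possible only at the ends of that range, where the edges may share a
vertex. -/
theorem chord_le_chord (h : IsDrawing x y E) {i j k l : V} (hE : E i j) (hE' : E k l) {t₀ t : ℝ}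
    (h₀ : chord x y i j t₀ < chord x y k l t₀) (hi₀ : x i < t₀) (hj₀ : t₀ < x j) (hk₀ : x k < t₀)
    (hl₀ : t₀ < x l) (hi : x i ≤ t) (hj : t ≤ x j) (hk : x k ≤ t) (hl : t ≤ x l) :
    chord x y i j t ≤ chord x y k l t := by
  have := ((chord_isAff x y k l).sub (chord_isAff x y i j)).nonneg_of_ne_zero
    (a := max (x i) (x k)) (b := min (x j) (x l)) (t₀ := t₀) (t := t) ?_ (sub_pos.2 h₀)
    (max_lt hi₀ hk₀) (lt_min hj₀ hl₀) (max_le hi hk) (le_min hj hl)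
  · linarith
  · intro s h₁ h₂ he
    rw [max_lt_iff] at h₁
    rw [lt_min_iff] at h₂
    obtain ⟨rfl, rfl⟩ := h.eq_of_chord_eq hE hE' s h₁.1 h₂.1 h₁.2 h₂.2 (by linarith)
    exact lt_irrefl _ h₀

theorem chord_lt_chord (h : IsDrawing x y E) {i j k l : V} (hE : E i j) (hE' : E k l) {t₀ t : ℝ}
    (h₀ : chord x y i j t₀ < chord x y k l t₀) (hi₀ : x i < t₀) (hj₀ : t₀ < x j) (hk₀ : x k < t₀)
    (hl₀ : t₀ < x l) (hi : x i < t) (hj : t < x j) (hk : x k < t) (hl : t < x l) :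
    chord x y i j t < chord x y k l t := by
  refine (h.chord_le_chord hE hE' h₀ hi₀ hj₀ hk₀ hl₀ hi.le hj.le hk.le hl.le).lt_of_ne fun he => ?_
  obtain ⟨rfl, rfl⟩ := h.eq_of_chord_eq hE hE' t hi hj hk hl he
  exact lt_irrefl _ h₀

/-- Two right edges at `v` of the same slope coincide. -/
theorem eq_of_slp_eq (h : IsDrawing x y E) {v s t : V} (hs : E v s) (ht : E v t) (he : slp x y v s = slp x y v t) :
    s = t := by
  obtain ⟨r, h₁, h₂⟩ := exists_between (lt_min (h.lt hs) (h.lt ht))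
  rw [lt_min_iff] at h₂
  exact (h.eq_of_chord_eq hs ht r h₁ h₂.1 h₁ h₂.2 (by unfold chord; rw [he])).2

/-- The region to the right of `v` between two edges, up to the first point `r` in it, contains
no part of another edge. -/
theorem exists_gap_end [Finite V] (h : IsDrawing x y E) {v k b k' b' : V} (hE : E k b)
    (hE' : E k' b')
    (hk : x k ≤ x v) (hb : x v < x b) (hk' : x k' ≤ x v) (hb' : x v < x b')
    (hlt : ∀ t, x v < t → t < x b → t < x b' → chord x y k' b' t < chord x y k b t)
    (hno : ∀ i j, E i j → x i ≤ x v → ∀ t, x v < t → t < x j → t < x b → t < x b' →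
      chord x y k' b' t < chord x y i j t → chord x y i j t < chord x y k b t → False) :
    ∃ r, x v < x r ∧ x r ≤ x b ∧ x r ≤ x b' ∧ chord x y k' b' (x r) ≤ y r ∧
      y r ≤ chord x y k b (x r) ∧
      (∀ i, x v < x i → x i < x r → chord x y k' b' (x i) ≤ y i → y i ≤ chord x y k b (x i) →
        False) ∧
      (∀ i j t, E i j → x i < t → t < x j → x v < t → t < x r →
        chord x y k' b' t < chord x y i j t → chord x y i j t < chord x y k b t → False) := by
  have hle : ∀ t, x v ≤ t → t ≤ x b → t ≤ x b' → chord x y k' b' t ≤ chord x y k b t := by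
    intro t h₁ h₂ h₃
    have := ((chord_isAff x y k b).sub (chord_isAff x y k' b')).nonneg_of_pos
      (a := x v) (b := min (x b) (x b')) (t := t) (lt_min hb hb') ?_ h₁ (le_min h₂ h₃)
    · linarith
    · intro s h₁ h₂
      rw [lt_min_iff] at h₂
      exact sub_pos.2 (hlt s h₁ h₂.1 h₂.2)
  -- The points of the closed region; whichever of `b`, `b'` is further left belongs to it. The
  -- leftmost such point is the `r` sought.
  let Q : Set V := {r | x v < x r ∧ x r ≤ x b ∧ x r ≤ x b' ∧ chord x y k' b' (x r) ≤ y r ∧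
      y r ≤ chord x y k b (x r)}
  have hQ : Q.Nonempty := by
    rcases le_total (x b) (x b') with hbb | hbb
    · refine ⟨b, hb, le_rfl, hbb, ?_, (chord_right (h.lt hE)).ge⟩
      rw [← chord_right (y := y) (h.lt hE)]
      exact hle _ hb.le le_rfl hbb
    · refine ⟨b', hb', hbb, le_rfl, (chord_right (h.lt hE')).le, ?_⟩
      rw [← chord_right (y := y) (h.lt hE')]
      exact hle _ hb'.le hbb le_rfl
  obtain ⟨r, ⟨h₁, h₂, h₃, h₄, h₅⟩, hmin⟩ := Set.exists_min_image Q x Q.toFinite hQ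
  refine ⟨r, h₁, h₂, h₃, h₄, h₅, ?_, ?_⟩
  · intro i hi₁ hi₂ hi₃ hi₄
    exact (hmin i ⟨hi₁, by linarith, by linarith, hi₃, hi₄⟩).not_gt hi₂
  · intro i j t hij hit htj hvt htr hlo hup
    rcases le_or_gt (x i) (x v) with hiv | hiv
    · exact hno i j hij hiv t hvt htj (by linarith) (by linarith) hlo hup
    -- An edge that starts to the right of `v` cannot cross the bounding edges, so its left end
    -- would be a point of the region to the left of `r`.
    · refine (hmin i ⟨hiv, by linarith, by linarith, ?_, ?_⟩).not_gt (by linarith)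
      · rw [← chord_left (x := x) (y := y) i j]
        exact h.chord_le_chord hE' hij hlo (by linarith) (by linarith) hit htj (by linarith)
          (by linarith) le_rfl (by linarith)
      · rw [← chord_left (x := x) (y := y) i j]
        exact h.chord_le_chord hij hE hup hit htj (by linarith) (by linarith) le_rfl
          (by linarith) (by linarith) (by linarith)

end IsDrawing

/-! ### Consecutive edges and the first edge above a point -/

/-- The edges from `v` to `s` and `t` are consecutive right edges at `v`, with `t` above `s`. -/
structure IsNext (x y : V → ℝ) (E : V → V → Prop) (v s t : V) : Prop where
  left : E v s
  right : E v t
  lt : slp x y v s < slp x y v t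
  not_between : ∀ u, E v u → slp x y v s < slp x y v u → slp x y v u < slp x y v t → False

theorem IsNext.right_unique (h : IsDrawing x y E) {v s t t' : V} (h₁ : IsNext x y E v s t)
    (h₂ : IsNext x y E v s t') : t = t' := by
  rcases lt_trichotomy (slp x y v t) (slp x y v t') with hlt | he | hlt
  · exact (h₂.not_between t h₁.right h₁.lt hlt).elim
  · exact h.eq_of_slp_eq h₁.right h₂.right he
  · exact (h₁.not_between t' h₂.right h₂.lt hlt).elim

theorem IsNext.left_unique (h : IsDrawing x y E) {v s s' t : V} (h₁ : IsNext x y E v s t)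
    (h₂ : IsNext x y E v s' t) : s = s' := by
  rcases lt_trichotomy (slp x y v s) (slp x y v s') with hlt | he | hlt
  · exact (h₁.not_between s' h₂.left hlt h₂.lt).elim
  · exact h.eq_of_slp_eq h₁.left h₂.left he
  · exact (h₂.not_between s h₁.left hlt h₁.lt).elim

/-- The edge from `v` to `b` is the first one met by the upward vertical ray from `w`. -/
structure IsFirstAbove (x y : V → ℝ) (E : V → V → Prop) (v b w : V) : Prop where
  edge : E v b
  left_lt : x v < x w
  lt_right : x w < x b
  lt_chord : y w < chord x y v b (x w)
  le : ∀ k l, E k l → x k < x w → x w < x l → y w < chord x y k l (x w) →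
    chord x y v b (x w) ≤ chord x y k l (x w)

theorem IsFirstAbove.neg_x (h : IsDrawing x y E) {v b w : V} (hf : IsFirstAbove x y E v b w) :
    IsFirstAbove (fun k => -x k) y (fun i j => E j i) b v w where
  edge := hf.edge
  left_lt := neg_lt_neg hf.lt_right
  lt_right := neg_lt_neg hf.left_lt
  lt_chord := by rw [chord_neg_x (h.lt hf.edge), neg_neg]; exact hf.lt_chord
  le k l hE h₁ h₂ h₃ := by
    rw [chord_neg_x (h.lt hE), neg_neg] at h₃
    rw [chord_neg_x (h.lt hf.edge), chord_neg_x (h.lt hE), neg_neg]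
    exact hf.le l k hE (neg_lt_neg_iff.1 h₂) (neg_lt_neg_iff.1 h₁) h₃

theorem IsFirstAbove.unique (h : IsDrawing x y E) {v b v' b' w : V}
    (h₁ : IsFirstAbove x y E v b w) (h₂ : IsFirstAbove x y E v' b' w) : v = v' ∧ b = b' :=
  h.eq_of_chord_eq h₁.edge h₂.edge (x w) h₁.left_lt h₁.lt_right h₂.left_lt h₂.lt_right
    (le_antisymm (h₁.le _ _ h₂.edge h₂.left_lt h₂.lt_right h₂.lt_chord)
      (h₂.le _ _ h₁.edge h₁.left_lt h₁.lt_right h₁.lt_chord))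

/-- Some segment between two of the points passes strictly above `w`. -/
def IsCovered (x y : V → ℝ) (w : V) : Prop :=
  ∃ a b, x a < x w ∧ x w < x b ∧ y w < chord x y a b (x w)

theorem IsFirstAbove.isCovered {v b w : V} (h : IsFirstAbove x y E v b w) : IsCovered x y w :=
  ⟨v, b, h.left_lt, h.lt_right, h.lt_chord⟩

end Drawing

/-! ### Existence of edges in maximal drawings -/

theorem exists_lex_max {α : Type*} [Finite α] {s : Set α} (hs : s.Nonempty) (f g : α → ℝ) :
    ∃ a ∈ s, ∀ b ∈ s, f b ≤ f a ∧ (f b = f a → g b ≤ g a) := by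
  obtain ⟨a, ha, hmax⟩ := Set.exists_max_image s f s.toFinite hs
  obtain ⟨c, ⟨hc, hfc⟩, hmax'⟩ := Set.exists_max_image {b ∈ s | f b = f a} g (Set.toFinite _)
    ⟨a, ha, rfl⟩
  exact ⟨c, hc, fun b hb => ⟨hfc ▸ hmax b hb, fun he => hmax' b ⟨hb, he.trans hfc⟩⟩⟩

section Drawing

variable {V : Type*} {x y : V → ℝ} {E : V → V → Prop}

namespace IsMaxDrawing

/-- A segment between consecutive points on a supporting line is an edge. -/
theorem edge_of_supporting (h : IsMaxDrawing x y E) {a b : V} (hab : x a < x b)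
    (hall : ∀ c, y c ≤ chord x y a b (x c))
    (hno : ∀ c, x a < x c → x c < x b → y c ≠ chord x y a b (x c)) : E a b := by
  refine h.maximal hab hno fun k l hE t h₁ h₂ h₃ h₄ he => ?_
  have haff := (chord_isAff x y a b).sub (chord_isAff x y k l)
  have hk : 0 ≤ chord x y a b (x k) - chord x y k l (x k) := by
    rw [chord_left]; linarith [hall k]
  have hl : 0 ≤ chord x y a b (x l) - chord x y k l (x l) := by
    rw [chord_right (h.lt hE)]; linarith [hall l]
  have h0 : ¬(0 < chord x y a b (x k) - chord x y k l (x k) ∨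
      0 < chord x y a b (x l) - chord x y k l (x l)) := by
    intro hor
    have := haff.pos_of_mem hk hl hor h₃ h₄
    linarith
  push Not at h0
  -- An edge that touches the supporting line in its interior lies on that line. Since neither
  -- segment has a point in its interior, the two coincide.
  have heq := haff.eq_zero (le_antisymm h0.1 hk) (le_antisymm h0.2 hl) (h.lt hE).ne
  have hkE : chord x y a b (x k) = y k := by have := heq (x k); rw [chord_left] at this; linarith
  have hlE : chord x y a b (x l) = y l := by
    have := heq (x l); rw [chord_right (h.lt hE)] at this; linarith
  have hka : x k ≤ x a := by
    by_contra! hlt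
    exact hno k hlt (by linarith) hkE.symm
  have hbl : x b ≤ x l := by
    by_contra! hlt
    exact hno l (by linarith) hlt hlE.symm
  constructor
  · refine h.inj (le_antisymm ?_ hka)
    by_contra! hlt
    exact h.ne_chord hE a hlt (by linarith)
      (by have := heq (x a); rw [chord_left] at this; linarith)
  · refine h.inj (le_antisymm hbl ?_)
    by_contra! hlt
    exact h.ne_chord hE b (by linarith) hlt
      (by have := heq (x b); rw [chord_right hab] at this; linarith)

/-- Among the segments over `w`, take the highest one above `w` and, in case of ties, the shortest.
Its line is supporting, as replacing an end by a point above the line would give a higher segment;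
being shortest, it has no point in its interior. So it is an edge of the convex hull. -/
theorem exists_edge_above [Finite V] (h : IsMaxDrawing x y E) {w : V} (hw : IsCovered x y w) :
    ∃ a b, E a b ∧ x a < x w ∧ x w < x b ∧ y w < chord x y a b (x w) := by
  obtain ⟨a₀, b₀, h₁, h₂, h₃⟩ := hw
  obtain ⟨⟨a, b⟩, ⟨haw, hwb⟩, hmax⟩ := exists_lex_max (α := V × V)
    (s := {q | x q.1 < x w ∧ x w < x q.2}) ⟨(a₀, b₀), h₁, h₂⟩
    (fun q => chord x y q.1 q.2 (x w)) (fun q => x q.1 - x q.2)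
  simp only at haw hwb hmax
  have hlt : y w < chord x y a b (x w) := h₃.trans_le (hmax (a₀, b₀) ⟨h₁, h₂⟩).1
  have hab : x a < x b := haw.trans hwb
  refine ⟨a, b, h.edge_of_supporting hab (fun c => ?_) (fun c hac hcb he => ?_), haw, hwb, hlt⟩
  · by_contra! hc
    rcases lt_trichotomy (x c) (x w) with hcw | hcw | hcw
    · have hcb : x c < x b := hcw.trans hwb
      have := ((chord_isAff x y c b).sub (chord_isAff x y a b)).pos_of_mem (p := x c) (q := x b)
        (by rw [chord_left]; linarith) (by rw [chord_right hcb, chord_right hab, sub_self])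
        (Or.inl (by rw [chord_left]; linarith)) hcw hwb
      linarith [(hmax (c, b) ⟨hcw, hwb⟩).1]
    · rw [h.inj hcw] at hc; linarith
    · have hac : x a < x c := haw.trans hcw
      have := ((chord_isAff x y a c).sub (chord_isAff x y a b)).pos_of_mem (p := x a) (q := x c)
        (by rw [chord_left, chord_left, sub_self]) (by rw [chord_right hac]; linarith)
        (Or.inr (by rw [chord_right hac]; linarith)) haw hcw
      linarith [(hmax (a, c) ⟨haw, hcw⟩).1]
  · rcases lt_trichotomy (x c) (x w) with hcw | hcw | hcw
    · have := (hmax (c, b) ⟨hcw, hwb⟩).2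
        (chord_eq_of_isAff (chord_isAff x y a b) hcb he.symm (chord_right hab) _)
      simp only at this; linarith
    · rw [h.inj hcw] at he; linarith
    · have := (hmax (a, c) ⟨haw, hcw⟩).2
        (chord_eq_of_isAff (chord_isAff x y a b) hac (chord_left _ _) he.symm _)
      simp only at this; linarith

theorem exists_isFirstAbove [Finite V] (h : IsMaxDrawing x y E) {w : V} (hw : IsCovered x y w) :
    ∃ v b, IsFirstAbove x y E v b w := by
  obtain ⟨a, b, hab⟩ := h.exists_edge_above hw
  obtain ⟨⟨v, b⟩, ⟨h₁, h₂, h₃, h₄⟩, hmin⟩ := Set.exists_min_image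
    {q : V × V | E q.1 q.2 ∧ x q.1 < x w ∧ x w < x q.2 ∧ y w < chord x y q.1 q.2 (x w)}
    (fun q => chord x y q.1 q.2 (x w)) (Set.toFinite _) ⟨(a, b), hab⟩
  exact ⟨v, b, h₁, h₂, h₃, h₄, fun k l hE g₁ g₂ g₃ => hmin (k, l) ⟨hE, g₁, g₂, g₃⟩⟩

/-- If no edge and no point separates `l` from `r` in the region between the lines `α` and `β`,
then the segment from `l` to `r` runs along one of these lines. -/
theorem eq_or_eq_of_gap (h : IsMaxDrawing x y E) {l r : V} (hlr : x l < x r) {α β : ℝ → ℝ}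
    (hα : IsAff α) (hβ : IsAff β) (hl : α (x l) ≤ y l) (hl' : y l ≤ β (x l))
    (hr : α (x r) ≤ y r) (hr' : y r ≤ β (x r))
    (hpt : ∀ i, x l < x i → x i < x r → α (x i) ≤ y i → y i ≤ β (x i) → False)
    (hedge : ∀ i j t, E i j → x i < t → t < x j → x l < t → t < x r →
      α t < chord x y i j t → chord x y i j t < β t → False) :
    (y l = α (x l) ∧ y r = α (x r)) ∨ (y l = β (x l) ∧ y r = β (x r)) := by
  by_contra hcon
  rw [not_or, not_and_or, not_and_or] at hcon
  have hlo : ∀ t, x l < t → t < x r → α t < chord x y l r t := fun t h₁ h₂ => by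
    have := ((chord_isAff x y l r).sub hα).pos_of_mem (p := x l) (q := x r)
      (by rw [chord_left]; linarith) (by rw [chord_right hlr]; linarith) (by
        rw [chord_left, chord_right hlr, sub_pos, sub_pos]
        exact hcon.1.imp (fun g => hl.lt_of_ne (Ne.symm g)) (fun g => hr.lt_of_ne (Ne.symm g)))
        h₁ h₂
    linarith
  have hup : ∀ t, x l < t → t < x r → chord x y l r t < β t := fun t h₁ h₂ => by
    have := (hβ.sub (chord_isAff x y l r)).pos_of_mem (p := x l) (q := x r)
      (by rw [chord_left]; linarith) (by rw [chord_right hlr]; linarith) (by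
        rw [chord_left, chord_right hlr, sub_pos, sub_pos]
        exact hcon.2.imp (fun g => hl'.lt_of_ne g) (fun g => hr'.lt_of_ne g))
        h₁ h₂
    linarith
  have hE : E l r := by
    refine h.maximal hlr (fun k h₁ h₂ he => ?_) (fun i j hE t h₁ h₂ h₃ h₄ he => ?_)
    · exact hpt k h₁ h₂ (he ▸ (hlo _ h₁ h₂).le) (he ▸ (hup _ h₁ h₂).le)
    · exact (hedge i j t hE h₃ h₄ h₁ h₂ (he ▸ hlo t h₁ h₂) (he ▸ hup t h₁ h₂)).elim
  -- The new edge itself runs inside the gap, which `hedge` forbids.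
  obtain ⟨t, h₁, h₂⟩ := exists_between hlr
  exact hedge l r t hE h₁ h₂ h₁ h₂ (hlo t h₁ h₂) (hup t h₁ h₂)

/-- The steepest direction to the right, with the nearest point in it, gives a supporting line: a
point above this line and to the left of `v` would produce a segment covering `v`. -/
theorem exists_right_edge_of_not_isCovered [Finite V] (h : IsMaxDrawing x y E) {v u : V}
    (hvu : x v < x u) (hv : ¬IsCovered x y v) : ∃ r, E v r := by
  obtain ⟨r, hvr, hmax⟩ := exists_lex_max (s := {r | x v < x r}) ⟨u, hvu⟩ (slp x y v)
    (fun r => -x r)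
  simp only [Set.mem_ofPred_eq] at hvr hmax
  refine ⟨r, h.edge_of_supporting hvr (fun c => ?_) (fun c hc hcr he => ?_)⟩
  · rcases lt_trichotomy (x c) (x v) with hcv | hcv | hcv
    · by_contra! hlt
      have hcr := hcv.trans hvr
      have := ((chord_isAff x y c r).sub (chord_isAff x y v r)).pos_of_mem (p := x c) (q := x r)
        (by rw [chord_left]; linarith) (by rw [chord_right hcr, chord_right hvr, sub_self])
        (Or.inl (by rw [chord_left]; linarith)) hcv hvr
      rw [chord_left] at this
      exact hv ⟨c, r, hcv, hvr, by linarith⟩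
    · rw [h.inj hcv, chord_left]
    · by_contra! hlt
      rw [← chord_right (y := y) hcv] at hlt
      exact (hmax c hcv).1.not_gt (slp_lt_of_chord_lt hcv hlt)
  · have hs : slp x y v c = slp x y v r := by
      have h1 : x c - x v ≠ 0 := by linarith
      rw [slp, he, chord]
      field_simp; ring
    linarith [(hmax c hc).2 hs]

/-- If `v` had no right edge, the region to its right between the first edges above and below would
be free of edges up to its first point. That point could be joined to `v`, which lies strictly
between both edges. -/
theorem exists_right_edge [Finite V] (h : IsMaxDrawing x y E) {v u : V} (hvu : x v < x u) :
    ∃ r, E v r := by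
  by_cases hup : IsCovered x y v
  swap
  · exact h.exists_right_edge_of_not_isCovered hvu hup
  by_cases hlo : IsCovered x (fun k => -y k) v
  swap
  · exact h.neg_y.exists_right_edge_of_not_isCovered hvu hlo
  by_contra! hno
  obtain ⟨k, b, hT⟩ := h.exists_isFirstAbove hup
  obtain ⟨k', b', hB⟩ := h.neg_y.exists_isFirstAbove hlo
  have hBlt : chord x y k' b' (x v) < y v := by
    have := hB.lt_chord; rw [chord_neg_y] at this; linarith
  have hTlt := hT.lt_chord
  obtain ⟨r, hvr, hrb, hrb', hr, hr', hpt, hedge⟩ := h.exists_gap_end (v := v) hT.edge hB.edge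
    hT.left_lt.le hT.lt_right hB.left_lt.le hB.lt_right
    (fun t h₁ h₂ h₃ => h.chord_lt_chord hB.edge hT.edge (hBlt.trans hTlt) hB.left_lt hB.lt_right
      hT.left_lt hT.lt_right (hB.left_lt.trans h₁) h₃ (hT.left_lt.trans h₁) h₂) (by
    intro i j hE hiv t hvt htj htb htb' hlo hup
    rcases hiv.eq_or_lt with hiv | hiv
    · exact hno j (h.inj hiv ▸ hE)
    · have hup' := h.chord_lt_chord hE hT.edge hup (hiv.trans hvt) htj (hT.left_lt.trans hvt) htb
        hiv (hvt.trans htj) hT.left_lt hT.lt_right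
      have hlo' := h.chord_lt_chord hB.edge hE hlo (hB.left_lt.trans hvt) htb' (hiv.trans hvt) htj
        hB.left_lt hB.lt_right hiv (hvt.trans htj)
      rcases lt_or_gt_of_ne (h.ne_chord hE v hiv (hvt.trans htj)) with hlt | hlt
      · exact (hT.le i j hE hiv (hvt.trans htj) hlt).not_gt hup'
      · have := hB.le i j hE hiv (hvt.trans htj) (by rw [chord_neg_y]; linarith)
        rw [chord_neg_y, chord_neg_y] at this
        linarith)
  rcases h.eq_or_eq_of_gap hvr (chord_isAff x y k' b') (chord_isAff x y k b) hBlt.le hTlt.le hr hr'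
    hpt hedge with hc | hc
  · linarith [hc.1]
  · linarith [hc.1]

/-! ### Faces of a maximal drawing are triangles -/

/-- The right neighbour of `w` on the boundary of the face below the edge from `v` to `b`. -/
theorem exists_right_neighbor [Finite V] (h : IsMaxDrawing x y E) {v b w : V}
    (hF : IsFirstAbove x y E v b w) :
    ∃ u, E w u ∧ x u ≤ x b ∧ (u = b ∨ IsFirstAbove x y E v b u) ∧
      (∀ i, x w < x i → x i < x u → chord x y w u (x i) ≤ y i → y i ≤ chord x y v b (x i) →
        False) ∧
      (∀ i j t, E i j → x i < t → t < x j → x w < t → t < x u →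
        chord x y w u t < chord x y i j t → chord x y i j t < chord x y v b t → False) := by
  obtain ⟨u, hu, hmax⟩ := Set.exists_max_image {u | E w u} (slp x y w) (Set.toFinite _)
    (h.exists_right_edge hF.lt_right)
  simp only [Set.mem_ofPred_eq] at hu hmax
  have hwu := h.lt hu
  have hFlt := hF.lt_chord
  obtain ⟨r, hwr, hrb, hru, hr, hr', hpt, hedge⟩ := h.exists_gap_end (v := w) hF.edge hu
    hF.left_lt.le hF.lt_right le_rfl hwu (by
      intro t h₁ h₂ h₃
      by_contra! hle
      rcases hle.eq_or_lt with he | hlt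
      · have := (h.eq_of_chord_eq hF.edge hu t (hF.left_lt.trans h₁) h₂ h₁ h₃ he).1
        rw [this] at hF
        exact lt_irrefl _ hF.left_lt
      · have := h.chord_le_chord hF.edge hu hlt (hF.left_lt.trans h₁) h₂ h₁ h₃ hF.left_lt.le
          hF.lt_right.le le_rfl hwu.le
        rw [chord_left] at this
        linarith) (by
      intro i j hE hiw t hwt htj htb htu hlo hup
      rcases hiw.eq_or_lt with hiw | hiw
      · obtain rfl := h.inj hiw
        exact (hmax j hE).not_gt (slp_lt_of_chord_lt hwt hlo)
      · have hlo' := h.chord_le_chord hu hE hlo hwt htu (hiw.trans hwt) htj le_rfl hwu.le hiw.le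
          (hwt.trans htj).le
        rw [chord_left] at hlo'
        exact (hF.le i j hE hiw (hwt.trans htj)
          (hlo'.lt_of_ne (h.ne_chord hE w hiw (hwt.trans htj)))).not_gt
          (h.chord_lt_chord hE hF.edge hup (hiw.trans hwt) htj (hF.left_lt.trans hwt) htb hiw
            (hwt.trans htj) hF.left_lt hF.lt_right))
  -- The segment from `w` to `r` runs along `w u` or along `v b`. The latter is impossible because
  -- `w` is strictly below `v b`, and the edge `w u` has no point in its interior.
  obtain rfl : r = u := by
    rcases h.eq_or_eq_of_gap hwr (chord_isAff x y w u) (chord_isAff x y v b) (chord_left _ _).le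
      hFlt.le hr hr' hpt hedge with hc | hc
    · by_contra hne
      exact h.ne_chord hu r hwr (hru.lt_of_ne fun g => hne (h.inj g)) hc.2
    · linarith [hc.1]
  refine ⟨r, hu, hrb, ?_, hpt, hedge⟩
  by_cases hrb' : r = b
  · exact Or.inl hrb'
  have hrb' : x r < x b := hrb.lt_of_ne fun g => hrb' (h.inj g)
  have hvr : x v < x r := hF.left_lt.trans hwr
  refine Or.inr ⟨hF.edge, hvr, hrb', hr'.lt_of_ne (h.ne_chord hF.edge r hvr hrb'), ?_⟩
  intro k l hE hkr hrl hlt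
  by_contra! hlt'
  -- An edge between `r` and `v b` would reach into the empty gap just to the left of `r`.
  obtain ⟨t, ht, htr⟩ := exists_between (max_lt hkr hwr)
  rw [max_lt_iff] at ht
  refine hedge k l t hE ht.1 (htr.trans hrl) ht.2 htr ?_ ?_
  · by_contra! hle
    rcases hle.eq_or_lt with he | hlt₂
    · have := (h.eq_of_chord_eq hE hu t ht.1 (htr.trans hrl) ht.2 htr he).2
      rw [this] at hrl
      exact lt_irrefl _ hrl
    · have := h.chord_le_chord hE hu hlt₂ ht.1 (htr.trans hrl) ht.2 htr hkr.le hrl.le hwr.le le_rfl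
      rw [chord_right hwr] at this
      linarith
  · exact h.chord_lt_chord hE hF.edge hlt' hkr hrl hvr hrb' ht.1 (htr.trans hrl)
      (hF.left_lt.trans ht.2) (htr.trans hrb')

theorem exists_left_neighbor [Finite V] (h : IsMaxDrawing x y E) {v b w : V}
    (hF : IsFirstAbove x y E v b w) :
    ∃ u, E u w ∧ x v ≤ x u ∧ (u = v ∨ IsFirstAbove x y E v b u) ∧
      (∀ i, x u < x i → x i < x w → chord x y u w (x i) ≤ y i → y i ≤ chord x y v b (x i) →
        False) ∧
      (∀ i j t, E i j → x i < t → t < x j → x u < t → t < x w →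
        chord x y u w t < chord x y i j t → chord x y i j t < chord x y v b t → False) := by
  obtain ⟨u, hu, hvu, hor, hpt, hedge⟩ := h.neg_x.exists_right_neighbor (hF.neg_x h.toIsDrawing)
  have hvb := h.lt hF.edge
  have huw := h.lt hu
  refine ⟨u, hu, neg_le_neg_iff.1 hvu, hor.imp_right fun g => ?_, ?_, ?_⟩
  · simpa using g.neg_x h.neg_x.toIsDrawing
  · intro i h₁ h₂ h₃ h₄
    refine hpt i (neg_lt_neg h₂) (neg_lt_neg h₁) ?_ ?_
    · rwa [chord_neg_x huw, neg_neg]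
    · rwa [chord_neg_x hvb, neg_neg]
  · intro i j t hE h₁ h₂ h₃ h₄ h₅ h₆
    refine hedge j i (-t) hE (neg_lt_neg h₂) (neg_lt_neg h₁) (neg_lt_neg h₄) (neg_lt_neg h₃) ?_ ?_
    · rwa [chord_neg_x huw, chord_neg_x (h.lt hE), neg_neg]
    · rwa [chord_neg_x hvb, chord_neg_x (h.lt hE), neg_neg]

/-- In a maximal drawing the face below an edge which is the first one above `w` is the triangle
spanned by this edge and `w`. -/
theorem triangle_of_isFirstAbove [Finite V] (h : IsMaxDrawing x y E) {v b w : V}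
    (hF : IsFirstAbove x y E v b w) :
    E v w ∧ (∀ i j t, E i j → x i < t → t < x j → x v < t → t < x w →
        chord x y v w t < chord x y i j t → chord x y i j t < chord x y v b t → False) := by
  have hvb := h.lt hF.edge
  -- Choose the point of the face with the largest vertical distance to `v b`, the rightmost one in
  -- case of ties. Then the right neighbour `d` is strictly closer to `v b`, so the segment joining
  -- the neighbours `c` and `d` passes strictly above `m`.
  obtain ⟨m, hm, hmax⟩ := exists_lex_max (s := {m | IsFirstAbove x y E v b m}) ⟨w, hF⟩
    (fun m => chord x y v b (x m) - y m) x
  simp only [Set.mem_ofPred_eq] at hm hmax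
  obtain ⟨c, hc, hvc, hc', hcpt, hcedge⟩ := h.exists_left_neighbor hm
  obtain ⟨d, hd, hdb, hd', hdpt, hdedge⟩ := h.exists_right_neighbor hm
  have hcm := h.lt hc
  have hmd := h.lt hd
  have hcd := hcm.trans hmd
  have hmlt := hm.lt_chord
  have hDc : 0 ≤ chord x y v b (x c) - y c := by
    rcases hc' with rfl | hc'
    · simp
    · linarith [hc'.lt_chord]
  have hDc' : chord x y v b (x c) - y c ≤ chord x y v b (x m) - y m := by
    rcases hc' with rfl | hc'
    · rw [chord_left]; linarith
    · exact (hmax c hc').1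
  have hDd : 0 ≤ chord x y v b (x d) - y d := by
    rcases hd' with rfl | hd'
    · rw [chord_right hvb, sub_self]
    · linarith [hd'.lt_chord]
  have hDd' : chord x y v b (x d) - y d < chord x y v b (x m) - y m := by
    rcases hd' with rfl | hd'
    · rw [chord_right hvb]; linarith
    · refine (hmax d hd').1.lt_of_ne fun he => ?_
      linarith [(hmax d hd').2 he]
  have hmcd : y m < chord x y c d (x m) := by
    have haff : IsAff fun t => (chord x y c d t - chord x y v b t) -
        (fun _ => y m - chord x y v b (x m)) t :=
      ((chord_isAff x y c d).sub (chord_isAff x y v b)).sub ⟨0, y m - chord x y v b (x m), by simp⟩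
    have := haff.pos_of_mem (p := x c) (q := x d) (by simp only [chord_left]; linarith)
      (by simp only [chord_right hcd]; linarith) (Or.inr (by simp only [chord_right hcd]; linarith))
      hcm hmd
    simp only at this
    linarith
  have hlo₁ : ∀ t, x c < t → t < x m → chord x y c m t < chord x y c d t := fun t h₁ h₂ => by
    have := ((chord_isAff x y c d).sub (chord_isAff x y c m)).pos_of_mem (p := x c) (q := x m)
      (by simp) (by rw [chord_right hcm]; linarith) (Or.inr (by rw [chord_right hcm]; linarith))
      h₁ h₂
    linarith
  have hlo₂ : ∀ t, x m < t → t < x d → chord x y m d t < chord x y c d t := fun t h₁ h₂ => by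
    have := ((chord_isAff x y c d).sub (chord_isAff x y m d)).pos_of_mem (p := x m) (q := x d)
      (by rw [chord_left]; linarith) (by rw [chord_right hcd, chord_right hmd, sub_self])
      (Or.inl (by rw [chord_left]; linarith)) h₁ h₂
    linarith
  -- Otherwise `c d` runs strictly below `v b` through the empty face, so it is an edge by
  -- maximality and separates `m` from `v b`.
  have hcv_db : c = v ∧ d = b := by
    by_contra hne
    have hup : ∀ t, x c < t → t < x d → chord x y c d t < chord x y v b t := fun t h₁ h₂ => by
      have := ((chord_isAff x y v b).sub (chord_isAff x y c d)).pos_of_mem (p := x c) (q := x d)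
        (by rw [chord_left]; linarith) (by rw [chord_right hcd]; linarith) (by
          rw [chord_left, chord_right hcd]
          rcases hc' with hc' | hc'
          · rcases hd' with hd' | hd'
            · exact (hne ⟨hc', hd'⟩).elim
            · exact Or.inr (by linarith [hd'.lt_chord])
          · exact Or.inl (by linarith [hc'.lt_chord])) h₁ h₂
      linarith
    have hE : E c d := by
      refine h.maximal hcd (fun k h₁ h₂ he => ?_) (fun i j hE t h₁ h₂ h₃ h₄ he => ?_)
      · have hu := hup _ h₁ h₂
        rcases lt_trichotomy (x k) (x m) with hk | hk | hk
        · exact hcpt k h₁ hk (he ▸ (hlo₁ _ h₁ hk).le) (he ▸ hu.le)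
        · rw [h.inj hk] at he; linarith
        · exact hdpt k hk h₂ (he ▸ (hlo₂ _ hk h₂).le) (he ▸ hu.le)
      · have hu := hup t h₁ h₂
        exfalso
        rcases lt_trichotomy t (x m) with ht | ht | ht
        · exact hcedge i j t hE h₃ h₄ h₁ ht (he ▸ hlo₁ t h₁ ht) (he ▸ hu)
        · subst ht
          exact (hm.le i j hE h₃ h₄ (he ▸ hmcd)).not_gt (he ▸ hu)
        · exact hdedge i j t hE h₃ h₄ ht h₂ (he ▸ hlo₂ t ht h₂) (he ▸ hu)
    exact (hm.le c d hE hcm hmd hmcd).not_gt (hup _ hcm hmd)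
  obtain ⟨rfl, rfl⟩ := hcv_db
  -- A different `w` would either be a point in the empty triangle or be separated from the edge
  -- above it by a side at `m`.
  obtain rfl : w = m := by
    rcases lt_trichotomy (x w) (x m) with hwm | hwm | hwm
    · exfalso
      rcases le_or_gt (chord x y c m (x w)) (y w) with hle | hlt
      · exact hcpt w hF.left_lt hwm hle hF.lt_chord.le
      · exact (hF.le c m hc hF.left_lt hwm hlt).not_gt (hlo₁ _ hF.left_lt hwm)
    · exact h.inj hwm
    · exfalso
      rcases le_or_gt (chord x y m d (x w)) (y w) with hle | hlt
      · exact hdpt w hwm hF.lt_right hle hF.lt_chord.le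
      · exact (hF.le m d hd hwm hF.lt_right hlt).not_gt (hlo₂ _ hwm hF.lt_right)
  exact ⟨hc, hcedge⟩

/-- An edge at `v` between `v w` and `v b` would enter the empty triangle below the first edge `v b`
above `w`. -/
theorem exists_isNext_of_isCovered [Finite V] (h : IsMaxDrawing x y E) {w : V}
    (hw : IsCovered x y w) : ∃ v b, IsNext x y E v w b ∧ x w < x b := by
  obtain ⟨v, b, hF⟩ := h.exists_isFirstAbove hw
  obtain ⟨hvw, hedge⟩ := h.triangle_of_isFirstAbove hF
  refine ⟨v, b, ⟨hvw, hF.edge, slp_lt_of_chord_lt hF.left_lt ?_, fun u hu h₁ h₂ => ?_⟩,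
    hF.lt_right⟩
  · rw [chord_right hF.left_lt]; exact hF.lt_chord
  · obtain ⟨t, hvt, ht⟩ := exists_between (lt_min hF.left_lt (h.lt hu))
    rw [lt_min_iff] at ht
    exact hedge v u t hu hvt ht.2 hvt ht.1 (chord_lt_of_slp_lt hvt h₁) (chord_lt_of_slp_lt hvt h₂)

theorem exists_isNext_of_isCovered_neg [Finite V] (h : IsMaxDrawing x y E) {w : V}
    (hw : IsCovered x (fun k => -y k) w) : ∃ v b, IsNext x y E v b w ∧ x w < x b := by
  obtain ⟨v, b, hN, hwb⟩ := h.neg_y.exists_isNext_of_isCovered hw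
  have hs : ∀ i j, slp x (fun k => -y k) i j = -slp x y i j := fun i j => by unfold slp; ring
  refine ⟨v, b, ⟨hN.right, hN.left, ?_, fun u hu h₁ h₂ => ?_⟩, hwb⟩
  · have := hN.lt
    rw [hs, hs] at this; linarith
  · exact hN.not_between u hu (by rw [hs, hs]; linarith) (by rw [hs, hs]; linarith)

end IsMaxDrawing

/-! ### Counting the edges of a drawing -/

/-- Distinct edges keep their vertical order also from a common end of their ranges. -/
theorem IsDrawing.chord_lt_chord_of_le (h : IsDrawing x y E) {i j k l : V} (hE : E i j)
    (hE' : E k l) {t₀ t : ℝ} (h₀ : chord x y i j t₀ < chord x y k l t₀) (hi₀ : x i ≤ t₀)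
    (hj₀ : t₀ ≤ x j) (hk₀ : x k ≤ t₀) (hl₀ : t₀ ≤ x l) (hi : x i < t) (hj : t < x j) (hk : x k < t)
    (hl : t < x l) : chord x y i j t < chord x y k l t := by
  by_contra! hle
  rcases hle.eq_or_lt with he | hlt
  · obtain ⟨rfl, rfl⟩ := h.eq_of_chord_eq hE' hE t hk hl hi hj he
    exact lt_irrefl _ h₀
  · exact (h.chord_le_chord hE' hE hlt hk hl hi hj hk₀ hl₀ hi₀ hj₀).not_gt h₀

theorem exists_isNext [Finite V] {v s t : V} (hs : E v s) (ht : E v t)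
    (hst : slp x y v s < slp x y v t) : ∃ t, IsNext x y E v s t := by
  obtain ⟨t, ⟨h₁, h₂⟩, hmin⟩ := Set.exists_min_image {t | E v t ∧ slp x y v s < slp x y v t}
    (slp x y v) (Set.toFinite _) ⟨t, ht, hst⟩
  exact ⟨t, hs, h₁, h₂, fun u hu g₁ g₂ => (hmin u ⟨hu, g₁⟩).not_gt g₂⟩

/-- A pair of consecutive right edges determines a point that is directly below the upper edge
or directly above the lower one. -/
theorem IsNext.exists_isFirstAbove [Finite V] (h : IsDrawing x y E) (hx : Function.Injective x)
    {v s t : V} (hN : IsNext x y E v s t) :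
    (∃ w, IsFirstAbove x y E v t w) ∨ ∃ w, IsFirstAbove x (fun k => -y k) E v s w := by
  have hvs := h.lt hN.left
  have hvt := h.lt hN.right
  have hlt : ∀ r, x v < r → chord x y v s r < chord x y v t r :=
    fun r hr => chord_lt_of_slp_lt hr hN.lt
  obtain ⟨w, hvw, hwt, hws, hw, hw', -, hedge⟩ := h.exists_gap_end (v := v) hN.right hN.left le_rfl
    hvt le_rfl hvs (fun r h₁ _ _ => hlt r h₁) (by
      intro i j hE hiv r hvr hrj hrt hrs hlo hup
      rcases hiv.eq_or_lt with hiv | hiv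
      · obtain rfl := hx hiv
        exact hN.not_between j hE (slp_lt_of_chord_lt hvr hlo) (slp_lt_of_chord_lt hvr hup)
      · have g₁ := h.chord_le_chord hN.left hE hlo hvr hrs (hiv.trans hvr) hrj le_rfl hvs.le hiv.le
          (hvr.trans hrj).le
        have g₂ := h.chord_le_chord hE hN.right hup (hiv.trans hvr) hrj hvr hrt hiv.le
          (hvr.trans hrj).le le_rfl hvt.le
        rw [chord_left] at g₁ g₂
        exact h.ne_chord hE v hiv (hvr.trans hrj) (le_antisymm g₁ g₂))
  have hno : ∀ k l, E k l → x k < x w → x w < x l → chord x y v s (x w) < chord x y k l (x w) →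
      chord x y k l (x w) < chord x y v t (x w) → False := by
    intro k l hE hkw hwl hlo hup
    obtain ⟨r, hr, hrw⟩ := exists_between (max_lt hkw hvw)
    rw [max_lt_iff] at hr
    exact hedge k l r hE hr.1 (hrw.trans hwl) hr.2 hrw
      (h.chord_lt_chord_of_le hN.left hE hlo hvw.le hws hkw.le hwl.le hr.2 (hrw.trans_le hws) hr.1
        (hrw.trans hwl))
      (h.chord_lt_chord_of_le hE hN.right hup hkw.le hwl.le hvw.le hwt hr.1 (hrw.trans hwl) hr.2
        (hrw.trans_le hwt))
  -- If the wedge's first point `w` comes before `t`, it is directly below `v t`. Otherwise `w` has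
  -- the abscissa of `t`, so `s` lies further right and `w` is directly above `v s`.
  rcases hwt.lt_or_eq with hwt' | hwt'
  · refine Or.inl ⟨w, hN.right, hvw, hwt', hw'.lt_of_ne (h.ne_chord hN.right w hvw hwt'), ?_⟩
    intro k l hE hkw hwl hlt
    by_contra! hup
    exact hno k l hE hkw hwl (hw.trans_lt hlt) hup
  · have hws' : x w < x s := hws.lt_of_ne fun hws' => by
      have := hN.lt
      rw [hx (hwt'.symm.trans hws')] at this
      exact lt_irrefl _ this
    refine Or.inr ⟨w, hN.left, hvw, hws', ?_, ?_⟩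
    · rw [chord_neg_y]
      exact neg_lt_neg (hw.lt_of_ne (h.ne_chord hN.left w hvw hws').symm)
    · intro k l hE hkw hwl hlt
      rw [chord_neg_y] at hlt ⊢
      rw [chord_neg_y]
      by_contra! hlo
      exact hno k l hE hkw hwl (neg_lt_neg_iff.1 hlo) ((neg_lt_neg_iff.1 hlt).trans_le hw')

open Classical in
/-- The number of edges of a crossing-free drawing is at most a quantity that depends only on
the points. -/
theorem IsDrawing.card_le [Fintype V] (h : IsDrawing x y E) (hx : Function.Injective x) :
    (Finset.univ.filter fun q : V × V => E q.1 q.2).card ≤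
      (Finset.univ.filter fun v : V => ∃ u, x v < x u).card +
      (Finset.univ.filter fun w : V => IsCovered x y w).card +
      (Finset.univ.filter fun w : V => IsCovered x (fun k => -y k) w).card := by
  -- Edges in `top` are charged to their left end. The others are charged to the first point of the
  -- wedge above them, which is directly below the upper edge (`up`) or directly above the edge
  -- itself (`lo`).
  let top : Finset (V × V) := Finset.univ.filter fun q : V × V =>
    E q.1 q.2 ∧ ∀ t, E q.1 t → slp x y q.1 t ≤ slp x y q.1 q.2
  let up : Finset (V × V) := Finset.univ.filter fun q : V × V =>
    ∃ t w, IsNext x y E q.1 q.2 t ∧ IsFirstAbove x y E q.1 t w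
  let lo : Finset (V × V) := Finset.univ.filter fun q : V × V =>
    ∃ w, IsFirstAbove x (fun k => -y k) E q.1 q.2 w
  have hsub : (Finset.univ.filter fun q : V × V => E q.1 q.2) ⊆ top ∪ up ∪ lo := by
    rintro ⟨v, s⟩ hq
    simp only [Finset.mem_filter, Finset.mem_univ, true_and, Finset.mem_union, top, up, lo] at hq ⊢
    by_cases htop : ∀ t, E v t → slp x y v t ≤ slp x y v s
    · exact Or.inl (Or.inl ⟨hq, htop⟩)
    push Not at htop
    obtain ⟨t, ht, hst⟩ := htop
    obtain ⟨t, hN⟩ := exists_isNext hq ht hst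
    rcases hN.exists_isFirstAbove h hx with ⟨w, hw⟩ | ⟨w, hw⟩
    · exact Or.inl (Or.inr ⟨t, w, hN, hw⟩)
    · exact Or.inr ⟨w, hw⟩
  refine (Finset.card_le_card hsub).trans ((Finset.card_union_le _ _).trans (add_le_add
    ((Finset.card_union_le _ _).trans (add_le_add ?_ ?_)) ?_))
  · refine Finset.card_le_card_of_injOn Prod.fst (fun q hq => ?_) ?_
    · simp only [Finset.coe_filter, Finset.mem_univ, true_and, Set.mem_ofPred_eq, top] at hq ⊢
      exact ⟨q.2, h.lt hq.1⟩
    · rintro ⟨v, s⟩ hq ⟨v', s'⟩ hq' (rfl : v = v')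
      simp only [Finset.coe_filter, Finset.mem_univ, true_and, Set.mem_ofPred_eq, top] at hq hq'
      rw [h.eq_of_slp_eq hq.1 hq'.1 (le_antisymm (hq'.2 s hq.1) (hq.2 s' hq'.1))]
  · refine Finset.card_le_card_of_forall_subsingleton
      (fun q w => ∃ t, IsNext x y E q.1 q.2 t ∧ IsFirstAbove x y E q.1 t w) ?_ ?_
    · intro q hq
      simp only [Finset.mem_filter, Finset.mem_univ, true_and, up] at hq ⊢
      obtain ⟨t, w, hN, hw⟩ := hq
      exact ⟨w, hw.isCovered, t, hN, hw⟩
    · rintro w - ⟨v, s⟩ ⟨-, t, hN, hw⟩ ⟨v', s'⟩ ⟨-, t', hN', hw'⟩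
      simp only at hN hw hN' hw'
      obtain ⟨rfl, rfl⟩ := hw.unique h hw'
      rw [hN.left_unique h hN']
  · refine Finset.card_le_card_of_forall_subsingleton
      (fun q w => IsFirstAbove x (fun k => -y k) E q.1 q.2 w) ?_ ?_
    · intro q hq
      simp only [Finset.mem_filter, Finset.mem_univ, true_and, lo] at hq ⊢
      obtain ⟨w, hw⟩ := hq
      exact ⟨w, hw.isCovered, hw⟩
    · rintro w - ⟨v, s⟩ ⟨-, hw⟩ ⟨v', s'⟩ ⟨-, hw'⟩
      simp only at hw hw'
      obtain ⟨rfl, rfl⟩ := hw.unique h.neg_y hw'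
      rfl

-- The bound of `IsDrawing.card_le` is attained. A point that is not rightmost yields its topmost
-- right edge; a point `w` covered from above yields `v w`, whose successor ends further right; a
-- point `w` covered from below yields the edge preceding `v w`, whose successor ends further left.
-- These three kinds of edges exclude each other.
open Classical in
theorem IsMaxDrawing.le_card [Fintype V] (h : IsMaxDrawing x y E) :
    (Finset.univ.filter fun v : V => ∃ u, x v < x u).card +
      (Finset.univ.filter fun w : V => IsCovered x y w).card +
      (Finset.univ.filter fun w : V => IsCovered x (fun k => -y k) w).card ≤
      (Finset.univ.filter fun q : V × V => E q.1 q.2).card := by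
  let top : Finset (V × V) := Finset.univ.filter fun q : V × V =>
    E q.1 q.2 ∧ ∀ t, E q.1 t → slp x y q.1 t ≤ slp x y q.1 q.2
  let up : Finset (V × V) := Finset.univ.filter fun q : V × V =>
    ∃ t, IsNext x y E q.1 q.2 t ∧ x q.2 < x t
  let lo : Finset (V × V) := Finset.univ.filter fun q : V × V =>
    ∃ t, IsNext x y E q.1 q.2 t ∧ x t < x q.2
  have htop : (Finset.univ.filter fun v : V => ∃ u, x v < x u).card ≤ top.card := by
    refine Finset.card_le_card_of_forall_subsingleton (fun v q => q.1 = v) (fun v hv => ?_) ?_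
    · simp only [Finset.mem_filter, Finset.mem_univ, true_and] at hv
      obtain ⟨u, hu⟩ := hv
      obtain ⟨s, hs, hmax⟩ := Set.exists_max_image {u | E v u} (slp x y v) (Set.toFinite _)
        (h.exists_right_edge hu)
      exact ⟨(v, s), by simpa [top] using ⟨hs, hmax⟩, rfl⟩
    · rintro ⟨v, s⟩ - a ⟨-, rfl⟩ b ⟨-, rfl⟩
      rfl
  have hup : (Finset.univ.filter fun w : V => IsCovered x y w).card ≤ up.card := by
    refine Finset.card_le_card_of_forall_subsingleton (fun w q => q.2 = w) (fun w hw => ?_) ?_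
    · simp only [Finset.mem_filter, Finset.mem_univ, true_and] at hw
      obtain ⟨v, b, hN, hwb⟩ := h.exists_isNext_of_isCovered hw
      exact ⟨(v, w), by simpa [up] using ⟨b, hN, hwb⟩, rfl⟩
    · rintro ⟨v, s⟩ - a ⟨-, rfl⟩ b ⟨-, rfl⟩
      rfl
  have hlo : (Finset.univ.filter fun w : V => IsCovered x (fun k => -y k) w).card ≤ lo.card := by
    refine Finset.card_le_card_of_forall_subsingleton (fun w q => IsNext x y E q.1 q.2 w)
      (fun w hw => ?_) ?_
    · simp only [Finset.mem_filter, Finset.mem_univ, true_and] at hw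
      obtain ⟨v, b, hN, hwb⟩ := h.exists_isNext_of_isCovered_neg hw
      exact ⟨(v, b), by simpa [lo] using ⟨w, hN, hwb⟩, hN⟩
    · rintro ⟨v, s⟩ - a ⟨-, ha⟩ b ⟨-, hb⟩
      exact ha.right_unique h.toIsDrawing hb
  have hd₁ : Disjoint top up := by
    rw [Finset.disjoint_left]
    rintro ⟨v, s⟩ h₁ h₂
    simp only [Finset.mem_filter, Finset.mem_univ, true_and, top, up] at h₁ h₂
    obtain ⟨t, hN, -⟩ := h₂
    exact (h₁.2 t hN.right).not_gt hN.lt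
  have hd₂ : Disjoint (top ∪ up) lo := by
    rw [Finset.disjoint_left]
    rintro ⟨v, s⟩ h₁ h₂
    simp only [Finset.mem_filter, Finset.mem_univ, true_and, Finset.mem_union, top, up, lo]
      at h₁ h₂
    obtain ⟨t, hN, hts⟩ := h₂
    rcases h₁ with h₁ | ⟨t', hN', hst⟩
    · exact (h₁.2 t hN.right).not_gt hN.lt
    · rw [hN.right_unique h.toIsDrawing hN'] at hts
      exact lt_asymm hts hst
  refine (add_le_add (add_le_add htop hup) hlo).trans ?_
  rw [← Finset.card_union_of_disjoint hd₁, ← Finset.card_union_of_disjoint hd₂]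
  refine Finset.card_le_card ?_
  rintro ⟨v, s⟩ hq
  simp only [Finset.mem_filter, Finset.mem_univ, true_and, Finset.mem_union, top, up, lo] at hq ⊢
  rcases hq with (hq | ⟨t, hq, -⟩) | ⟨t, hq, -⟩
  · exact hq.1
  · exact hq.left
  · exact hq.left

end Drawing

/-! ### From points in the plane to drawings -/

section Plane

variable {n : ℕ} {p : Fin n → Plane}

/-- Some shear of the plane gives a finite set of points pairwise distinct abscissas. -/
theorem exists_shear (hp : Function.Injective p) :
    ∃ c : ℝ, Function.Injective fun i => p i 0 + c * p i 1 := by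
  -- These are the values of `c` for which two points get the same abscissa. For equal second
  -- coordinates the quotient is the default value 0, which is harmless: such points stay apart for
  -- every `c`.
  obtain ⟨c, hc⟩ := (Set.finite_range fun q : Fin n × Fin n =>
    -(p q.1 0 - p q.2 0) / (p q.1 1 - p q.2 1)).exists_notMem
  refine ⟨c, fun i j hij => hp ?_⟩
  simp only at hij
  have h1 : p i 1 = p j 1 := by
    by_contra h1
    refine hc ⟨(i, j), ?_⟩
    have : p i 1 - p j 1 ≠ 0 := sub_ne_zero.2 h1
    simp only
    field_simp
    linarith
  have h0 : p i 0 = p j 0 := by rw [h1] at hij; linarith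
  ext k
  fin_cases k
  · exact h0
  · exact h1

/-- The sheared abscissa and the second coordinate are linear coordinates of the plane, in which a
non-vertical segment is the graph of its chord. -/
theorem mem_openSegment_iff_chord {c : ℝ} {i j : Fin n}
    (hij : p i 0 + c * p i 1 < p j 0 + c * p j 1) (z : Plane) :
    z ∈ openSegment ℝ (p i) (p j) ↔ p i 0 + c * p i 1 < z 0 + c * z 1 ∧
      z 0 + c * z 1 < p j 0 + c * p j 1 ∧
      z 1 = chord (fun k => p k 0 + c * p k 1) (fun k => p k 1) i j (z 0 + c * z 1) := by
  set X : Plane → ℝ := fun z => z 0 + c * z 1 with hX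
  have hd : X (p j) - X (p i) ≠ 0 := by simp only [hX]; linarith
  constructor
  · rintro ⟨a, b, ha, hb, hab, rfl⟩
    obtain rfl : a = 1 - b := by linarith
    have hXz : X ((1 - b) • p i + b • p j) = X (p i) + b * (X (p j) - X (p i)) := by
      simp [hX]; ring
    have h₁ := mul_pos hb (sub_pos.2 hij)
    have h₂ := mul_pos ha (sub_pos.2 hij)
    simp only [hX] at hXz
    refine ⟨by rw [hXz]; linarith, by rw [hXz]; linarith, ?_⟩
    simp only [hX] at hd
    have hz : ((1 - b) • p i + b • p j : Plane) 1 = p i 1 + (p j 1 - p i 1) * b := by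
      simp; ring
    rw [hXz, chord, slp, hz, add_sub_cancel_left, ← mul_assoc, mul_right_comm,
      div_mul_cancel₀ _ hd]
  · rintro ⟨h₁, h₂, h₃⟩
    have hpos : 0 < X (p j) - X (p i) := sub_pos.2 hij
    set b := (X z - X (p i)) / (X (p j) - X (p i)) with hb
    have hbd : b * (X (p j) - X (p i)) = X z - X (p i) := by rw [hb]; field_simp
    have h1 : p i 1 + b * (p j 1 - p i 1) = z 1 := by
      rw [h₃, chord, slp, hb]; simp only [hX]; ring
    refine ⟨1 - b, b, ?_, div_pos (sub_pos.2 h₁) hpos, by ring, ?_⟩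
    · rw [sub_pos, hb, div_lt_one hpos]; simp only [hX]; linarith
    · have h0 : p i 0 + b * (p j 0 - p i 0) = z 0 := by
        simp only [hX] at hbd
        have : b * (p j 0 - p i 0) + c * (b * (p j 1 - p i 1)) =
          z 0 + c * z 1 - (p i 0 + c * p i 1) := by rw [← hbd]; ring
        rw [← h1] at this
        linarith
      ext k
      fin_cases k
      · simp; linarith
      · simp; linarith

theorem exists_coords (c s t : ℝ) : ∃ z : Plane, z 0 + c * z 1 = s ∧ z 1 = t :=
  ⟨!₂[s - c * t, t], by simp, by simp⟩

theorem CrossingFree.mono {G H : SimpleGraph (Fin n)} (hH : CrossingFree p H) (hGH : G ≤ H) :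
    CrossingFree p G :=
  ⟨fun i j h => hH.1 i j (hGH h), fun i j k l h₁ h₂ => hH.2 i j k l (hGH h₁) (hGH h₂)⟩

theorem CrossingFree.sup {G H : SimpleGraph (Fin n)} (hG : CrossingFree p G)
    (hH : CrossingFree p H) (hGH : ∀ i j k l, G.Adj i j → H.Adj k l → s(i, j) ≠ s(k, l) →
      Disjoint (openSegment ℝ (p i) (p j)) (openSegment ℝ (p k) (p l))) :
    CrossingFree p (G ⊔ H) := by
  refine ⟨?_, ?_⟩
  · rintro i j (h | h)
    · exact hG.1 i j h
    · exact hH.1 i j h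
  · rintro i j k l (h | h) (h' | h') hne
    · exact hG.2 i j k l h h' hne
    · exact hGH i j k l h h' hne
    · exact (hGH k l i j h' h hne.symm).symm
    · exact hH.2 i j k l h h' hne

theorem Sees.symm {i j : Fin n} (h : Sees p i j) : Sees p j i := fun k hk =>
  (h k (by rwa [segment_symm])).symm

theorem Sees.crossingFree_edge {i j : Fin n} (h : Sees p i j) :
    CrossingFree p (SimpleGraph.edge i j) := by
  refine ⟨fun a b hab => ?_, fun a b c d hab hcd hne => (hne ?_).elim⟩
  · rw [SimpleGraph.edge_adj] at hab
    rcases hab.1 with ⟨rfl, rfl⟩ | ⟨rfl, rfl⟩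
    · exact h
    · exact h.symm
  · rw [SimpleGraph.edge_adj] at hab hcd
    rcases hab.1 with ⟨rfl, rfl⟩ | ⟨rfl, rfl⟩ <;> rcases hcd.1 with ⟨rfl, rfl⟩ | ⟨rfl, rfl⟩ <;>
      simp [Sym2.eq_swap]

theorem CrossingFree.isDrawing {G : SimpleGraph (Fin n)} (hG : CrossingFree p G) (c : ℝ) :
    IsDrawing (fun k => p k 0 + c * p k 1) (fun k => p k 1)
      (fun i j => G.Adj i j ∧ p i 0 + c * p i 1 < p j 0 + c * p j 1) where
  lt h := h.2
  ne_chord := by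
    intro i j hE k h₁ h₂ he
    have := (mem_openSegment_iff_chord hE.2 (p k)).2 ⟨h₁, h₂, he⟩
    rcases hG.1 i j hE.1 k (openSegment_subset_segment ℝ _ _ this) with rfl | rfl
    · exact lt_irrefl _ h₁
    · exact lt_irrefl _ h₂
  eq_of_chord_eq := by
    intro i j k l hE hE' t h₁ h₂ h₃ h₄ he
    obtain ⟨z, hz, hz'⟩ := exists_coords c t
      (chord (fun k => p k 0 + c * p k 1) (fun k => p k 1) i j t)
    have hm := (mem_openSegment_iff_chord hE.2 z).2 ⟨hz ▸ h₁, hz ▸ h₂, hz ▸ hz'⟩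
    have hm' := (mem_openSegment_iff_chord hE'.2 z).2 ⟨hz ▸ h₃, hz ▸ h₄, hz ▸ hz'.trans he⟩
    by_contra hne
    refine Set.disjoint_left.1 (hG.2 i j k l hE.1 hE'.1 fun hs => ?_) hm hm'
    rw [Sym2.eq_iff] at hs
    rcases hs with hs | ⟨rfl, rfl⟩
    · exact hne hs
    · exact lt_asymm hE.2 hE'.2

theorem sees_of_openSegment (hp : Function.Injective p) {i j : Fin n}
    (h : ∀ k, p k ∉ openSegment ℝ (p i) (p j)) : Sees p i j := by
  intro k hk
  rw [← insert_endpoints_openSegment] at hk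
  rcases hk with hk | hk | hk
  · exact Or.inl (hp hk)
  · exact Or.inr (hp hk)
  · exact (h k hk).elim

theorem IsTriangulation.isMaxDrawing {M : SimpleGraph (Fin n)} (hM : IsTriangulation p M)
    (hp : Function.Injective p) {c : ℝ} (hc : Function.Injective fun i => p i 0 + c * p i 1) :
    IsMaxDrawing (fun k => p k 0 + c * p k 1) (fun k => p k 1)
      (fun i j => M.Adj i j ∧ p i 0 + c * p i 1 < p j 0 + c * p j 1) where
  toIsDrawing := hM.prop.isDrawing c
  inj := hc
  maximal := by
    intro i j hij hpt hcr
    have hne : i ≠ j := by rintro rfl; exact lt_irrefl _ hij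
    have hsees : Sees p i j := sees_of_openSegment hp fun k hk => by
      obtain ⟨h₁, h₂, h₃⟩ := (mem_openSegment_iff_chord hij (p k)).1 hk
      exact hpt k h₁ h₂ h₃
    have key : ∀ k l, M.Adj k l → p k 0 + c * p k 1 < p l 0 + c * p l 1 → s(i, j) ≠ s(k, l) →
        Disjoint (openSegment ℝ (p i) (p j)) (openSegment ℝ (p k) (p l)) := by
      intro k l hkl hlt hs
      rw [Set.disjoint_left]
      intro z hz hz'
      rw [mem_openSegment_iff_chord hij] at hz
      rw [mem_openSegment_iff_chord hlt] at hz'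
      obtain ⟨rfl, rfl⟩ := hcr k l ⟨hkl, hlt⟩ _ hz.1 hz.2.1 hz'.1 hz'.2.1
        (hz.2.2.symm.trans hz'.2.2)
      exact hs rfl
    have key' : ∀ k l, M.Adj k l → s(i, j) ≠ s(k, l) →
        Disjoint (openSegment ℝ (p i) (p j)) (openSegment ℝ (p k) (p l)) := by
      intro k l hkl hs
      rcases lt_or_gt_of_ne (hc.ne hkl.ne) with hlt | hlt
      · exact key k l hkl hlt hs
      · rw [openSegment_symm ℝ (p k)]
        exact key l k hkl.symm hlt (by rwa [Sym2.eq_swap (a := l)])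
    have hcf : CrossingFree p (M ⊔ SimpleGraph.edge i j) := by
      refine hM.prop.sup hsees.crossingFree_edge fun k l a b hkl hab hs => ?_
      rw [SimpleGraph.edge_adj] at hab
      rcases hab.1 with ⟨rfl, rfl⟩ | ⟨rfl, rfl⟩
      · exact (key' k l hkl hs.symm).symm
      · rw [openSegment_symm ℝ (p a)]
        exact (key' k l hkl (by rw [Sym2.eq_swap]; exact hs.symm)).symm
    refine ⟨hM.le_of_ge hcf le_sup_left ?_, hij⟩
    exact Or.inr ((SimpleGraph.edge_adj _ _ _ _).2 ⟨Or.inl ⟨rfl, rfl⟩, hne⟩)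

open Classical in
/-- The number of ordered pairs of adjacent vertices. -/
noncomputable def adjCount (G : SimpleGraph (Fin n)) : ℕ :=
  (Finset.univ.filter fun q : Fin n × Fin n => G.Adj q.1 q.2).card

open Classical in
theorem adjCount_eq {α : Type*} [LinearOrder α] (G : SimpleGraph (Fin n)) {x : Fin n → α}
    (hx : Function.Injective x) : adjCount G =
      2 * (Finset.univ.filter fun q : Fin n × Fin n => G.Adj q.1 q.2 ∧ x q.1 < x q.2).card := by
  have hswap : (Finset.univ.filter fun q : Fin n × Fin n => G.Adj q.1 q.2 ∧ x q.2 < x q.1).card =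
      (Finset.univ.filter fun q : Fin n × Fin n => G.Adj q.1 q.2 ∧ x q.1 < x q.2).card := by
    refine Finset.card_bij (fun q _ => q.swap) ?_ (fun _ _ _ _ h => Prod.swap_injective h) ?_
    · intro q hq
      simpa [G.adj_comm] using hq
    · intro q hq
      exact ⟨q.swap, by simpa [G.adj_comm] using hq, by simp⟩
  rw [two_mul]
  nth_rw 1 [← hswap]
  rw [← Finset.card_union_of_disjoint, adjCount]
  · congr 1
    ext q
    simp only [Finset.mem_filter, Finset.mem_univ, true_and, Finset.mem_union]
    constructor
    · intro h
      rcases lt_or_gt_of_ne (hx.ne h.ne) with hlt | hlt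
      · exact Or.inr ⟨h, hlt⟩
      · exact Or.inl ⟨h, hlt⟩
    · rintro (h | h) <;> exact h.1
  · rw [Finset.disjoint_left]
    intro q h₁ h₂
    simp only [Finset.mem_filter, Finset.mem_univ, true_and] at h₁ h₂
    exact lt_asymm h₁.2 h₂.2

theorem adjCount_sup {G H : SimpleGraph (Fin n)} (hGH : ∀ i j, G.Adj i j → ¬H.Adj i j) :
    adjCount (G ⊔ H) = adjCount G + adjCount H := by
  classical
  unfold adjCount
  rw [← Finset.card_union_of_disjoint]
  · congr 1
    ext q
    simp
  · rw [Finset.disjoint_left]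
    intro q h₁ h₂
    simp only [Finset.mem_filter, Finset.mem_univ, true_and] at h₁ h₂
    exact hGH _ _ h₁ h₂

/-- A triangulation has the largest number of edges among all crossing-free graphs. -/
theorem CrossingFree.adjCount_le {G M : SimpleGraph (Fin n)} (hG : CrossingFree p G)
    (hM : IsTriangulation p M) (hp : Function.Injective p) : adjCount G ≤ adjCount M := by
  obtain ⟨c, hc⟩ := exists_shear hp
  rw [adjCount_eq G hc, adjCount_eq M hc]
  refine Nat.mul_le_mul_left 2 ?_
  have h := ((hG.isDrawing c).card_le hc).trans (hM.isMaxDrawing hp hc).le_card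
  refine (le_of_eq ?_).trans (h.trans (le_of_eq ?_)) <;> congr

end Plane

/-! ### Total distance and number of edges -/

variable {n : ℕ}

open Classical in
theorem sum_adj_eq (G : SimpleGraph (Fin n)) :
    ((∑ i : Fin n, ∑ j ∈ Finset.Ioi i, if G.Adj i j then 1 else 0 : ℕ)) * 2 = adjCount G := by
  rw [adjCount_eq G (x := id) Function.injective_id, mul_comm]
  congr 1
  rw [Finset.card_filter, Fintype.sum_prod_type]
  refine Finset.sum_congr rfl fun i _ => ?_
  rw [← Finset.sum_filter_add_sum_filter_not Finset.univ (fun j => i < j)]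
  have hIoi : Finset.univ.filter (fun j => i < j) = Finset.Ioi i := by ext; simp
  rw [hIoi, Finset.sum_eq_zero (s := Finset.univ.filter fun j => ¬i < j), add_zero]
  · refine Finset.sum_congr rfl fun j hj => ?_
    simp [Finset.mem_Ioi.1 hj]
  · intro j hj
    simp at hj
    simp [hj]

theorem HasHandle.edist_le_two {F : SimpleGraph (Fin n)} (hF : HasHandle F) (i j : Fin n) :
    F.edist i j ≤ 2 := by
  obtain ⟨c, hc⟩ := hF
  have h1 : ∀ k, F.edist c k ≤ 1 := fun k => by
    by_cases hk : k = c
    · simp [hk]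
    · exact (SimpleGraph.edist_eq_one_iff_adj.2 (hc k hk)).le
  calc F.edist i j ≤ F.edist i c + F.edist c j := SimpleGraph.edist_triangle
    _ ≤ 1 + 1 := add_le_add (SimpleGraph.edist_comm ▸ h1 i) (h1 j)
    _ = 2 := by norm_num

open Classical in
theorem two_le_edist_add (G : SimpleGraph (Fin n)) {i j : Fin n} (hij : i ≠ j) :
    2 ≤ G.edist i j + (if G.Adj i j then 1 else 0 : ℕ) := by
  split_ifs with h
  · rw [SimpleGraph.edist_eq_one_iff_adj.2 h]; norm_num
  · have h1 : 1 ≤ G.edist i j := Order.one_le_iff_pos.2 (SimpleGraph.edist_pos_of_ne hij)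
    have h2 : (1 : ℕ∞) < G.edist i j := h1.lt_of_ne fun he =>
      h (SimpleGraph.edist_eq_one_iff_adj.1 he.symm)
    have := Order.add_one_le_of_lt h2
    simpa [one_add_one_eq_two] using this

open Classical in
theorem HasHandle.edist_add {F : SimpleGraph (Fin n)} (hF : HasHandle F) {i j : Fin n}
    (hij : i ≠ j) : F.edist i j + (if F.Adj i j then 1 else 0 : ℕ) = 2 := by
  refine le_antisymm ?_ (two_le_edist_add F hij)
  split_ifs with h
  · rw [SimpleGraph.edist_eq_one_iff_adj.2 h]; norm_num
  · simpa using hF.edist_le_two i j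

/-- A fan with at least as many edges as `T` has at most the total distance of `T`. -/
theorem HasHandle.totalDist_le {F T : SimpleGraph (Fin n)} (hF : HasHandle F)
    (hle : adjCount T ≤ adjCount F) : totalDist F ≤ totalDist T := by
  classical
  set e : SimpleGraph (Fin n) → ℕ := fun G =>
    ∑ i : Fin n, ∑ j ∈ Finset.Ioi i, if G.Adj i j then 1 else 0 with he
  have hsum : ∀ G : SimpleGraph (Fin n), totalDist G + (e G : ℕ∞) =
      ∑ i : Fin n, ∑ j ∈ Finset.Ioi i, (G.edist i j + (if G.Adj i j then 1 else 0 : ℕ)) := by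
    intro G
    simp only [totalDist, he, Nat.cast_sum, ← Finset.sum_add_distrib]
  have heTF : (e T : ℕ∞) ≤ e F := by
    rw [← sum_adj_eq, ← sum_adj_eq] at hle
    exact_mod_cast Nat.le_of_mul_le_mul_right hle two_pos
  -- The total distance of `T` may be `⊤`, so the finite number of edges is added on both sides
  -- instead of being subtracted.
  rw [← ENat.add_le_add_iff_right (k := (e F : ℕ∞)) (ENat.natCast_ne_top _)]
  calc totalDist F + (e F : ℕ∞) ≤ totalDist T + (e T : ℕ∞) := by
        rw [hsum, hsum]
        refine Finset.sum_le_sum fun i _ => Finset.sum_le_sum fun j hj => ?_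
        have hij := (Finset.mem_Ioi.1 hj).ne
        rw [hF.edist_add hij]
        exact two_le_edist_add T hij
    _ ≤ totalDist T + (e F : ℕ∞) := by gcongr

/-! ### Stars and fans of point sets -/

/-- The star with centre `c`. -/
def star (c : Fin n) : SimpleGraph (Fin n) where
  Adj i j := i ≠ j ∧ (i = c ∨ j = c)
  symm := ⟨fun _ _ h => ⟨h.1.symm, h.2.symm⟩⟩
  loopless := ⟨fun _ h => h.1 rfl⟩

theorem hasHandle_of_star_le {c : Fin n} {G : SimpleGraph (Fin n)} (h : star c ≤ G) :
    HasHandle G := ⟨c, fun _ hj => h ⟨hj.symm, Or.inl rfl⟩⟩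

theorem mem_segment_of_smul_eq {a b c : Plane} {s t : ℝ} (hs : 0 < s) (hst : s ≤ t)
    (h : (1 - t) • a + t • c = (1 - s) • a + s • b) : c ∈ segment ℝ a b := by
  have ht : 0 < t := hs.trans_le hst
  refine ⟨1 - s / t, s / t, ?_, by positivity, by ring, ?_⟩
  · rw [sub_nonneg, div_le_one ht]; exact hst
  · have hc : t • c = (t - s) • a + s • b := by
      have : t • c = ((1 - t) • a + t • c) - (1 - t) • a := by abel
      rw [this, h]; module
    have : c = t⁻¹ • (t • c) := by rw [smul_smul, inv_mul_cancel₀ ht.ne', one_smul]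
    rw [this, hc, smul_add, smul_smul, smul_smul]
    congr 2
    · field_simp
    · field_simp

/-- Two spokes that meet away from `c` lie on a common ray, so the nearer of the two ends blocks the
view from `c` to the other. -/
theorem disjoint_openSegment_of_sees {p : Fin n → Plane} {c i j : Fin n} (hi : Sees p c i)
    (hj : Sees p c j) (hci : c ≠ i) (hcj : c ≠ j) (hij : i ≠ j) :
    Disjoint (openSegment ℝ (p c) (p i)) (openSegment ℝ (p c) (p j)) := by
  rw [Set.disjoint_left]
  rintro z ⟨s', s, -, hs, hs1, rfl⟩ ⟨t', t, -, ht, ht1, h⟩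
  obtain rfl : s' = 1 - s := by linarith
  obtain rfl : t' = 1 - t := by linarith
  rcases le_total s t with hst | hst
  · rcases hi j (mem_segment_of_smul_eq hs hst h) with h' | h'
    · exact hcj h'.symm
    · exact hij h'.symm
  · rcases hj i (mem_segment_of_smul_eq ht hst h.symm) with h' | h'
    · exact hci h'.symm
    · exact hij h'

theorem crossingFree_star {p : Fin n → Plane} {c : Fin n} (hc : ∀ j, j ≠ c → Sees p c j) :
    CrossingFree p (star c) := by
  refine ⟨?_, ?_⟩
  · rintro i j ⟨hne, rfl | rfl⟩
    · exact hc j hne.symm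
    · exact (hc i hne).symm
  · have key : ∀ i j, i ≠ c → j ≠ c → i ≠ j →
        Disjoint (openSegment ℝ (p c) (p i)) (openSegment ℝ (p c) (p j)) := fun i j hi hj hij =>
      disjoint_openSegment_of_sees (hc i hi) (hc j hj) hi.symm hj.symm hij
    rintro i j k l ⟨hij, rfl | rfl⟩ ⟨hkl, rfl | rfl⟩ hne
    · exact key _ _ hij.symm hkl.symm fun h => hne (by rw [h])
    · rw [openSegment_symm ℝ (p k)]
      exact key _ _ hij.symm hkl fun h => hne (by rw [h, Sym2.eq_swap])
    · rw [openSegment_symm ℝ (p i)]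
      exact key _ _ hij hkl.symm fun h => hne (by rw [h, Sym2.eq_swap])
    · rw [openSegment_symm ℝ (p i), openSegment_symm ℝ (p k)]
      exact key _ _ hij hkl fun h => hne (by rw [h])

theorem OnePointVisible.exists_fan {p : Fin n → Plane} (h : OnePointVisible p) :
    ∃ F, IsTriangulation p F ∧ HasHandle F := by
  obtain ⟨c, hc⟩ := h
  obtain ⟨F, hF, hmax⟩ := Finite.exists_le_maximal (crossingFree_star hc)
  exact ⟨F, hmax, hasHandle_of_star_le hF⟩

/-! ### Triangulations of polygons -/

section Polygon

variable {P : Polygon Plane n}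

theorem boundary_eq (P : Polygon Plane n) :
    P.boundary ℝ = ⋃ i, segment ℝ (P i) (P (finRotate n i)) := by
  simp only [Polygon.boundary, Polygon.edgeSet, affineSegment_eq_segment]

theorem cycleGraph_adj_iff (hn : 3 ≤ n) {i j : Fin n} :
    (SimpleGraph.cycleGraph n).Adj i j ↔ j = finRotate n i ∨ i = finRotate n j := by
  obtain ⟨m, rfl⟩ : ∃ m, n = m + 2 := ⟨n - 2, by omega⟩
  rw [SimpleGraph.cycleGraph_adj, finRotate_apply, finRotate_apply, sub_eq_iff_eq_add,
    sub_eq_iff_eq_add, add_comm 1, add_comm 1, or_comm]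

theorem segment_subset_boundary (hn : 3 ≤ n) {i j : Fin n}
    (h : (SimpleGraph.cycleGraph n).Adj i j) : segment ℝ (P i) (P j) ⊆ P.boundary ℝ := by
  rw [boundary_eq]
  rcases (cycleGraph_adj_iff hn).1 h with rfl | rfl
  · exact Set.subset_iUnion (fun i => segment ℝ (P i) (P (finRotate n i))) i
  · rw [segment_symm]
    exact Set.subset_iUnion (fun i => segment ℝ (P i) (P (finRotate n i))) j

theorem vertex_mem_boundary (P : Polygon Plane n) (i : Fin n) : P i ∈ P.boundary ℝ := by
  rw [boundary_eq]
  exact Set.mem_iUnion.2 ⟨i, left_mem_segment ℝ _ _⟩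

/-- An open segment in a crossing-free extension of the boundary avoids the boundary. -/
theorem openSegment_subset_compl_boundary (hn : 3 ≤ n) (hP : Function.Injective P.vertices)
    {H : SimpleGraph (Fin n)} (hH : CrossingFree P.vertices H)
    (hcyc : SimpleGraph.cycleGraph n ≤ H) {i j : Fin n} (hij : H.Adj i j)
    (hnot : ¬(SimpleGraph.cycleGraph n).Adj i j) :
    openSegment ℝ (P i) (P j) ⊆ (P.boundary ℝ)ᶜ := by
  have hvert : ∀ k, P k ∉ openSegment ℝ (P i) (P j) := by
    intro k hk
    rcases hH.1 i j hij k (openSegment_subset_segment ℝ _ _ hk) with rfl | rfl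
    · exact hij.ne (hP (left_mem_openSegment_iff.1 hk))
    · exact hij.ne (hP (right_mem_openSegment_iff.1 hk))
  intro z hz hb
  rw [boundary_eq, Set.mem_iUnion] at hb
  obtain ⟨k, hk⟩ := hb
  have hadj : (SimpleGraph.cycleGraph n).Adj k (finRotate n k) :=
    (cycleGraph_adj_iff hn).2 (Or.inl rfl)
  rw [← insert_endpoints_openSegment] at hk
  rcases hk with rfl | rfl | hk
  · exact hvert _ hz
  · exact hvert _ hz
  · refine Set.disjoint_left.1 (hH.2 i j k _ hij (hcyc hadj) fun hs => hnot ?_) hz hk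
    rw [← SimpleGraph.mem_edgeSet, hs, SimpleGraph.mem_edgeSet]
    exact hadj

theorem IsDiagonal.symm {i j : Fin n} (h : IsDiagonal P i j) : IsDiagonal P j i :=
  ⟨h.1.symm, fun g => h.2.1 g.symm, by rw [openSegment_symm]; exact h.2.2⟩

theorem IsBoundaryEdgeOrDiagonal.symm {i j : Fin n} (h : IsBoundaryEdgeOrDiagonal P i j) :
    IsBoundaryEdgeOrDiagonal P j i := h.imp (fun g => g.symm) (fun g => g.symm)

theorem IsDiagonal.disjoint_boundary {i j : Fin n} (h : IsDiagonal P i j) :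
    Disjoint (openSegment ℝ (P i) (P j)) (P.boundary ℝ) :=
  Set.disjoint_left.2 fun _ hz => (h.2.2 hz).1

theorem IsSimplePolygon.sees (hP : IsSimplePolygon P) {i j : Fin n}
    (h : IsBoundaryEdgeOrDiagonal P i j) : Sees P.vertices i j := by
  rcases h with h | h
  · exact hP.2.2.1 i j h
  · exact sees_of_openSegment hP.2.1 fun k hk =>
      Set.disjoint_left.1 h.disjoint_boundary hk (vertex_mem_boundary P k)

/-- Diagonals avoid the boundary, so the star at the visible vertex and the boundary form a plane
graph, which extends to a maximal one. -/
theorem IsSimplePolygon.exists_fan (hP : IsSimplePolygon P) (h : OneVertexVisible P) :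
    ∃ F, IsPolygonTriangulation P F ∧ HasHandle F := by
  obtain ⟨c, hc⟩ := h
  have hstar : ∀ i j, (star c).Adj i j → IsBoundaryEdgeOrDiagonal P i j := by
    rintro i j ⟨hne, rfl | rfl⟩
    · exact hc j hne.symm
    · exact (hc i hne).symm
  have hplane : IsPolygonPlaneGraph P (SimpleGraph.cycleGraph n ⊔ star c) := by
    refine ⟨le_sup_left, ?_, ?_⟩
    · rintro i j (h | h)
      · exact Or.inl h
      · exact hstar i j h
    · refine hP.2.2.sup (crossingFree_star fun j hj => hP.sees (hc j hj)) ?_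
      intro i j k l hij hkl hne
      rcases hstar k l hkl with h | h
      · exact hP.2.2.2 i j k l hij h hne
      · exact (h.disjoint_boundary.mono_right ((openSegment_subset_segment ℝ _ _).trans
          (segment_subset_boundary hP.1 hij))).symm
  obtain ⟨F, hF, hmax⟩ := Finite.exists_le_maximal hplane
  exact ⟨F, hmax, hasHandle_of_star_le (le_sup_right.trans hF)⟩

/-- An edge that can be added to a polygon triangulation without crossings runs outside. -/
theorem IsPolygonTriangulation.disjoint_interior (hP : IsSimplePolygon P)
    {F H : SimpleGraph (Fin n)} (hF : IsPolygonTriangulation P F) (hFH : F ≤ H)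
    (hH : CrossingFree P.vertices H) {i j : Fin n} (hij : H.Adj i j) (hFij : ¬F.Adj i j) :
    Disjoint (openSegment ℝ (P i) (P j)) (polygonInterior P) := by
  have hnot : ¬(SimpleGraph.cycleGraph n).Adj i j := fun h => hFij (hF.prop.1 h)
  have hsub := openSegment_subset_compl_boundary hP.1 hP.2.1 hH (hF.prop.1.trans hFH) hij hnot
  rw [Set.disjoint_left]
  intro z hz hzP
  -- The open segment is connected and avoids the boundary, so it stays in one component of the
  -- complement. If it meets the interior, it is a diagonal that could be added to `F`.
  have hdiag : IsDiagonal P i j := by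
    refine ⟨hij.ne, hnot, fun w hw => ⟨hsub hw, ?_⟩⟩
    have := (convex_openSegment (𝕜 := ℝ) (P i) (P j)).isPreconnected.subset_connectedComponentIn
      hz hsub hw
    rw [← connectedComponentIn_eq this]
    exact hzP.2
  have hadd : IsPolygonPlaneGraph P (F ⊔ SimpleGraph.edge i j) := by
    refine ⟨hF.prop.1.trans le_sup_left, ?_, hH.mono (sup_le hFH ?_)⟩
    · rintro k l (h | h)
      · exact hF.prop.2.1 k l h
      · rw [SimpleGraph.edge_adj] at h
        rcases h.1 with ⟨rfl, rfl⟩ | ⟨rfl, rfl⟩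
        · exact Or.inr hdiag
        · exact Or.inr hdiag.symm
    · intro k l h
      rw [SimpleGraph.edge_adj] at h
      rcases h.1 with ⟨rfl, rfl⟩ | ⟨rfl, rfl⟩
      · exact hij
      · exact hij.symm
  exact hFij (hF.le_of_ge hadd le_sup_left
    (Or.inr ((SimpleGraph.edge_adj _ _ _ _).2 ⟨Or.inl ⟨rfl, rfl⟩, hij.ne⟩)))

/-- A polygon triangulation has the largest number of edges among the crossing-free graphs formed
by the boundary and diagonals. -/
theorem IsPolygonPlaneGraph.adjCount_le (hP : IsSimplePolygon P) {F T : SimpleGraph (Fin n)}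
    (hT : IsPolygonPlaneGraph P T) (hF : IsPolygonTriangulation P F) :
    adjCount T ≤ adjCount F := by
  obtain ⟨M, hFM, hM⟩ := Finite.exists_le_maximal hF.prop.2.2
  have hout : ∀ i j, (M \ F).Adj i j →
      Disjoint (openSegment ℝ (P i) (P j)) (polygonInterior P) := fun i j h =>
    hF.disjoint_interior hP hFM hM.prop h.1 h.2
  -- Exchange `F` for `T` inside `M`: boundary edges of `T` already belong to `M`, and diagonals of
  -- `T` run in the interior, which the edges of `M \ F` avoid.
  have hT' : CrossingFree P.vertices (T ⊔ M \ F) := by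
    refine hT.2.2.sup (hM.prop.mono sdiff_le) fun i j k l hij hkl hne => ?_
    rcases hT.2.1 i j hij with h | h
    · exact hM.prop.2 i j k l (hFM (hF.prop.1 h)) hkl.1 hne
    · exact ((hout k l hkl).mono_right h.2.2).symm
  have hdisj : ∀ i j, T.Adj i j → ¬(M \ F).Adj i j := by
    intro i j hij hX
    rcases hT.2.1 i j hij with h | h
    · exact hX.2 (hF.prop.1 h)
    · obtain ⟨z, hz⟩ : (openSegment ℝ (P i) (P j)).Nonempty :=
        ⟨_, midpoint_mem_openSegment _ _⟩
      exact Set.disjoint_left.1 (hout i j hX) hz (h.2.2 hz)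
  have h₁ := hT'.adjCount_le hM hP.2.1
  have h₂ : adjCount M = adjCount F + adjCount (M \ F) := by
    rw [← adjCount_sup (fun i j h (g : (M \ F).Adj i j) => g.2 h), sup_sdiff_cancel_right hFM]
  rw [adjCount_sup hdisj] at h₁
  omega

end Polygon

end MADT

theorem theorem1 :
    (∀ (n : ℕ) (P : Polygon MADT.Plane n),
      MADT.IsSimplePolygon P → MADT.OneVertexVisible P →
        (∃ F, MADT.IsPolygonTriangulation P F ∧ MADT.HasHandle F) ∧
        (∀ F F', MADT.IsPolygonTriangulation P F → MADT.HasHandle F →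
          MADT.IsPolygonTriangulation P F' → MADT.HasHandle F' →
            MADT.totalDist F = MADT.totalDist F') ∧
        (∀ F T, MADT.IsPolygonTriangulation P F → MADT.HasHandle F →
          MADT.IsPolygonTriangulation P T → MADT.totalDist F ≤ MADT.totalDist T)) ∧
    (∀ (n : ℕ) (p : Fin n → MADT.Plane),
      Function.Injective p → MADT.OnePointVisible p →
        (∃ F, MADT.IsTriangulation p F ∧ MADT.HasHandle F) ∧
        (∀ F F', MADT.IsTriangulation p F → MADT.HasHandle F →
          MADT.IsTriangulation p F' → MADT.HasHandle F' →
            MADT.totalDist F = MADT.totalDist F') ∧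
        (∀ F T, MADT.IsTriangulation p F → MADT.HasHandle F →
          MADT.IsTriangulation p T → MADT.totalDist F ≤ MADT.totalDist T)) := by
  refine ⟨fun n P hP hvis => ?_, fun n p hp hvis => ?_⟩
  · have hle : ∀ F T, MADT.IsPolygonTriangulation P F → MADT.HasHandle F →
        MADT.IsPolygonTriangulation P T → MADT.totalDist F ≤ MADT.totalDist T :=
      fun F T hF hh hT => hh.totalDist_le (hT.prop.adjCount_le hP hF)
    exact ⟨hP.exists_fan hvis, fun F F' hF hh hF' hh' =>
      le_antisymm (hle F F' hF hh hF') (hle F' F hF' hh' hF), hle⟩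
  · have hle : ∀ F T, MADT.IsTriangulation p F → MADT.HasHandle F →
        MADT.IsTriangulation p T → MADT.totalDist F ≤ MADT.totalDist T :=
      fun F T hF hh hT => hh.totalDist_le (hT.prop.adjCount_le hF hp)
    exact ⟨hvis.exists_fan, fun F F' hF hh hF' hh' =>
      le_antisymm (hle F F' hF hh hF') (hle F' F hF' hh' hF), hle⟩
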